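/- **Setting.** Let $\mathcal H$ be a complex Hilbert space and $H\ge 0$ a self-adjoint operator on $\mathcal H$ with $H\Omega=0$ for a unit vector $\Omega\in\mathcal H$ and $H\upharpoonright_{\{\mathbb C\Omega\}^{\perp}}\ge \mathbb 1$. For a finite set $S\subset\mathbb N$ of sites let $\mathcal H_S=\bigotimes_{j\in S}\mathcal H_j$ with $\mathcal H_j\simeq\mathcal H$, let $H_i$ be $H$ acting in the slot $i$, let $H^0_S=\sum_{i\in S}H_i$ and $\Omega_S=\bigotimes_{j\in S}\Omega_j$, and for $A\subseteq S$ let $P^{(-)}_A=\bigotimes_{j\in A}P_{\Omega_j}$ and $P^{(+)}_A=\mathbb 1-P^{(-)}_A$, where $P_{\Omega_j}$ projects onto $\mathbb C\Omega$ in the slot $j$. Put $I_{l,i}=\{i,\dots,i+l\}$. Let $k\ge 1$, $q\ge1$ and $I_{k,q}\subseteq\{1,\dots,N\}$, and let $t>0$. In the sums below, $I_{l,i}$ runs over the intervals $I_{l,i}\subset I_{k,q}$ with $1\le l\le k-1$. For each of these intervals let $V_{I_{l,i}}$ be the potential on $\mathcal H_{I_{l,i}}$ before the block-diagonalization step $(k,q)$,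 that is, a sesquilinear form on $D((H^0_{I_{l,i}})^{1/2})$ which * is symmetric; * is already block-diagonal: $V_{I_{l,i}}=P^{(+)}_{I_{l,i}}V_{I_{l,i}}P^{(+)}_{I_{l,i}}+P^{(-)}_{I_{l,i}}V_{I_{l,i}}P^{(-)}_{I_{l,i}}$; * obeys the inductive bound $\|V_{I_{l,i}}\|_{H^0}:=\|(H^0_{I_{l,i}}+1)^{-1/2}V_{I_{l,i}}(H^0_{I_{l,i}}+1)^{-1/2}\|\le t^{\frac{l-1}{4}}$. It acts as the identity on the sites of $I_{k,q}\setminus I_{l,i}$. With $\langle V_{I_{l,i}}\rangle=\langle\Omega_{I_{l,i}},V_{I_{l,i}}\Omega_{I_{l,i}}\rangle$, define on $\mathcal H_{I_{k,q}}$, in the sense of forms on $D((H^0_{I_{k,q}})^{1/2})$, $$G_{I_{k,q}}=\sum_{i\in I_{k,q}}H_i+t\sum_{l=1}^{k-1}\ \sum_{I_{l,i}\subset I_{k,q}}V_{I_{l,i}},\qquad E_{I_{k,q}}=t\sum_{l=1}^{k-1}\ \sum_{I_{l,i}\subset I_{k,q}}\langle V_{I_{l,i}}\rangle .$$ **Lemma.**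 If $c(t):=1-8t-4t\sum_{l=3}^{\infty}l\,t^{\frac{l-2}{4}}>0$, then $P^{(+)}_{I_{k,q}}$ maps $D((H^0_{I_{k,q}})^{1/2})$ into itself and, in the form sense on $D((H^0_{I_{k,q}})^{1/2})$, $$P^{(+)}_{I_{k,q}}\,(G_{I_{k,q}}-E_{I_{k,q}})\,P^{(+)}_{I_{k,q}}\ \ge\ c(t)\,H^0_{I_{k,q}}\,P^{(+)}_{I_{k,q}} .$$ **Corollary.** There is an absolute constant $t_0>0$ (in particular independent of $N$, $k$, $q$) such that the following holds whenever $0<t<t_0$. The form of $G_{I_{k,q}}$ is the form of a self-adjoint operator, again denoted $G_{I_{k,q}}$. The minimum of its spectrum is $E_{I_{k,q}}$; this is an eigenvalue whose eigenspace is spanned by the vacuum $\Omega_{I_{k,q}}$; and the rest of the spectrum is contained in $[E_{I_{k,q}}+\tfrac12,\infty)$. Moreover $$P^{(-)}_{I_{k,q}}G_{I_{k,q}}P^{(-)}_{I_{k,q}}=P^{(-)}_{I_{k,q}}\Big[t\sum_{l=1}^{k-1}\sum_{I_{l,i}\subset I_{k,q}}\langle V_{I_{l,i}}\rangle P^{(-)}_{I_{l,i}}\Big]P^{(-)}_{I_{k,q}}=P^{(-)}_{I_{k,q}}\Big[t\sum_{l=1}^{k-1}\sum_{I_{l,i}\subset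 I_{k,q}}\langle V_{I_{l,i}}\rangle\Big]P^{(-)}_{I_{k,q}} .$$ -/

import Mathlib

open scoped InnerProductSpace ComplexConjugate

noncomputable section

namespace QuantumChain

/-! ### Unbounded operators on a Hilbert space -/

section Operators

universe u

variable {E : Type u} [NormedAddCommGroup E] [InnerProductSpace ℂ E]

/-- `R` is the bounded inverse `(A - z)⁻¹`: the equation `(A - z) ψ = φ` with `ψ ∈ D(A)` holds
exactly for `ψ = R φ`. -/
def IsResolvent (A : E →ₗ.[ℂ] E) (z : ℂ) (R : E →L[ℂ] E) : Prop :=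
  ∀ φ ψ : E, ψ = R φ ↔ (ψ, φ + z • ψ) ∈ A.graph

/-- The spectrum of an unbounded operator: the complement of the resolvent set. -/
def spectrumOf (A : E →ₗ.[ℂ] E) : Set ℂ :=
  {z | ¬ ∃ R : E →L[ℂ] E, IsResolvent A z R}

open Classical in
/-- The bounded operator `(A + 1)⁻¹` (there is at most one; it exists for every non-negative
self-adjoint `A`; the default value `0` is not used for such `A`). -/
def invAddOne (A : E →ₗ.[ℂ] E) : E →L[ℂ] E :=
  if h : ∃ R : E →L[ℂ] E, IsResolvent A (-1) R then h.choose else 0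

variable [CompleteSpace E]

/-- `(A + 1)^{-1/2}`, for a non-negative self-adjoint `A`: the non-negative square root of the
bounded non-negative operator `(A + 1)⁻¹`. -/
def invSqrtAddOne (A : E →ₗ.[ℂ] E) : E →L[ℂ] E :=
  CFC.sqrt (invAddOne A)

/-- `(A + 1)^{1/2}`, the (unbounded) inverse of `(A + 1)^{-1/2}`. -/
def sqrtAddOne (A : E →ₗ.[ℂ] E) : E →ₗ.[ℂ] E :=
  (((invSqrtAddOne A : E →L[ℂ] E) : E →ₗ[ℂ] E).toPMap ⊤).inverse

/-- The form domain `D(A^{1/2}) = D((A + 1)^{1/2})`, i.e. the range of `(A + 1)^{-1/2}`. -/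
def formDomain (A : E →ₗ.[ℂ] E) : Submodule ℂ E :=
  LinearMap.range ((invSqrtAddOne A : E →L[ℂ] E) : E →ₗ[ℂ] E)

open Classical in
/-- The quadratic form of a non-negative self-adjoint operator,
`⟨A^{1/2} φ, A^{1/2} ψ⟩ = ⟨(A + 1)^{1/2} φ, (A + 1)^{1/2} ψ⟩ - ⟨φ, ψ⟩`, for `φ, ψ ∈ D(A^{1/2})`
(and `0` for other pairs of vectors). -/
def opForm (A : E →ₗ.[ℂ] E) (φ ψ : E) : ℂ :=
  if h : φ ∈ (sqrtAddOne A).domain ∧ ψ ∈ (sqrtAddOne A).domain then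
    ⟪sqrtAddOne A ⟨φ, h.1⟩, sqrtAddOne A ⟨ψ, h.2⟩⟫_ℂ - ⟪φ, ψ⟫_ℂ
  else 0

/-- `G` is the operator associated with the form `g` on the form domain `Q`:
`ψ ∈ D(G)` and `G ψ = η` if and only if `ψ ∈ Q` and `g(φ, ψ) = ⟨φ, η⟩` for all `φ ∈ Q`.
(This determines the graph of `G`, hence `G`.) -/
def IsOperatorOfForm (Q : Submodule ℂ E) (g : E → E → ℂ) (G : E →ₗ.[ℂ] E) : Prop :=
  ∀ ψ η : E, (ψ, η) ∈ G.graph ↔ ψ ∈ Q ∧ ∀ φ ∈ Q, g φ ψ = ⟪φ, η⟫_ℂ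

/-- The standing assumptions on the one-site Hamiltonian `H` and its vacuum `Ω`: `H` is self-adjoint
and non-negative, `Ω` is a unit vector with `H Ω = 0`, and `H ≥ 1` on the orthogonal complement
of `Ω`. -/
structure IsSiteHamiltonian (H : E →ₗ.[ℂ] E) (Ω : E) : Prop where
  selfAdjoint : IsSelfAdjoint H
  nonneg : ∀ ψ : H.domain, 0 ≤ (⟪(ψ : E), H ψ⟫_ℂ).re
  norm_vacuum : ‖Ω‖ = 1
  vacuum : (Ω, (0 : E)) ∈ H.graph
  gap : ∀ ψ : H.domain, ⟪Ω, (ψ : E)⟫_ℂ = 0 → ‖(ψ : E)‖ ^ 2 ≤ (⟪(ψ : E), H ψ⟫_ℂ).re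

end Operators

/-! ### Tensor products of copies of the one-site space

The one-site Hilbert space `𝓗` comes with an orthonormal basis `b` indexed by `ι`; the Hilbert tensor
product of the copies of `𝓗` at the sites in the finite set `S` is realized as `ℓ²(S → ι)`, in which
the family `f : S → ι` is the product basis vector `⊗_{j ∈ S} b (f j)`. -/

section Tensor

universe u v

variable {𝓗 : Type u} [NormedAddCommGroup 𝓗] [InnerProductSpace ℂ 𝓗]
variable {ι : Type v} (b : HilbertBasis ι ℂ 𝓗)

/-- The Hilbert space `⊗_{j ∈ S} 𝓗_j`. -/
abbrev TensorSpace (ι : Type v) (S : Finset ℕ) : Type v :=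
  lp (fun _ : S → ι => ℂ) 2

theorem memℓp_comp {α β : Type*} (e : α → β) (he : Function.Injective e)
    (ψ : lp (fun _ : β => ℂ) 2) : Memℓp (fun a => ψ (e a)) 2 := by
  have h := (memℓp_gen_iff (p := 2) (by norm_num)).1 (lp.memℓp ψ)
  exact (memℓp_gen_iff (p := 2) (by norm_num)).2 (h.comp_injective he)

/-- Restriction of a square-summable family along an injective map of the index sets. -/
def pullback {α β : Type*} (e : α → β) (he : Function.Injective e) :
    lp (fun _ : β => ℂ) 2 →ₗ[ℂ] lp (fun _ : α => ℂ) 2 where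
  toFun ψ := ⟨fun a => ψ (e a), memℓp_comp e he ψ⟩
  map_add' _ _ := by ext a; rfl
  map_smul' _ _ := by ext a; rfl

theorem sum_prod_le_prod_tsum {J : Type*} [Fintype J] {ι : Type*} (a : J → ι → ℝ)
    (h0 : ∀ j n, 0 ≤ a j n) (hs : ∀ j, Summable (a j)) (s : Finset (J → ι)) :
    ∑ f ∈ s, ∏ j, a j (f j) ≤ ∏ j, ∑' n, a j n := by
  classical
  calc ∑ f ∈ s, ∏ j, a j (f j)
      ≤ ∑ f ∈ Fintype.piFinset (fun j => s.image fun f => f j), ∏ j, a j (f j) := by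
        refine Finset.sum_le_sum_of_subset_of_nonneg (fun f hf => ?_)
          (fun f _ _ => Finset.prod_nonneg fun j _ => h0 j _)
        exact Fintype.mem_piFinset.2 fun j =>
          Finset.mem_image_of_mem (fun f : J → ι => f j) hf
    _ = ∏ j, ∑ n ∈ s.image (fun f => f j), a j n := (Finset.prod_univ_sum _ _).symm
    _ ≤ ∏ j, ∑' n, a j n := Finset.prod_le_prod (fun j _ => Finset.sum_nonneg fun n _ => h0 j n)
        fun j _ => (hs j).sum_le_tsum _ fun n _ => h0 j n

theorem memℓp_prod {S : Finset ℕ} (x : S → 𝓗) :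
    Memℓp (fun f : S → ι => ∏ j, b.repr (x j) (f j)) 2 := by
  refine memℓp_gen' (C := ∏ j, ∑' n, ‖b.repr (x j) n‖ ^ (2 : ENNReal).toReal) fun s => ?_
  have hs : ∀ j, Summable fun n => ‖b.repr (x j) n‖ ^ (2 : ENNReal).toReal := fun j =>
    (memℓp_gen_iff (p := 2) (by norm_num)).1 (lp.memℓp (b.repr (x j)))
  refine le_trans (le_of_eq (Finset.sum_congr rfl fun f _ => ?_))
    (sum_prod_le_prod_tsum (fun j n => ‖b.repr (x j) n‖ ^ (2 : ENNReal).toReal)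
      (fun j n => Real.rpow_nonneg (norm_nonneg _) _) hs s)
  rw [norm_prod, Real.finsetProd_rpow _ _ (fun _ _ => norm_nonneg _)]

/-- The product vector `⊗_{j ∈ S} x_j`. -/
def productVector (S : Finset ℕ) (x : S → 𝓗) : TensorSpace ι S :=
  ⟨fun f => ∏ j, b.repr (x j) (f j), memℓp_prod b x⟩

/-- The slice of `ψ` at the site `i`, the other sites being in the basis state `g`: the vector
`∑ₙ ψ(g with n at i) bₙ` of the one-site space. -/
def siteSlice {S : Finset ℕ} (i : S) (g : S → ι) : TensorSpace ι S →ₗ[ℂ] 𝓗 :=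
  (b.repr.symm.toLinearEquiv : lp (fun _ : ι => ℂ) 2 →ₗ[ℂ] 𝓗) ∘ₗ
    pullback (fun n => Function.update g i n) (Function.update_injective g i)

/-- The operator `1 ⊗ ⋯ ⊗ A ⊗ ⋯ ⊗ 1` with `A` in the slot `i`, acting slice by slice: its domain
consists of the `ψ` whose slices at `i` all lie in `D(A)` and whose image is square-summable. -/
def siteOperator (A : 𝓗 →ₗ.[ℂ] 𝓗) (S : Finset ℕ) (i : S) :
    TensorSpace ι S →ₗ.[ℂ] TensorSpace ι S :=
  (⨅ g : S → ι, A.graph.comap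
    ((siteSlice b i g).prodMap (siteSlice b i g))).toLinearPMap

/-- `H⁰_S = ∑_{i ∈ S} H_i`, on the intersection of the domains of the `H_i`. -/
def freeHamiltonian (H : 𝓗 →ₗ.[ℂ] 𝓗) (S : Finset ℕ) :
    TensorSpace ι S →ₗ.[ℂ] TensorSpace ι S :=
  ∑ i : S, siteOperator b H S i

/-- The configuration on `S` equal to `f` on `A` and to `g` on `S \ A`. -/
def merge {A S : Finset ℕ} (f : A → ι) (g : ↥(S \ A) → ι) : S → ι := fun j =>
  if h : (j : ℕ) ∈ A then f ⟨j, h⟩ else g ⟨j, Finset.mem_sdiff.2 ⟨j.2, h⟩⟩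

theorem merge_injective {A S : Finset ℕ} (h : A ⊆ S) (g : ↥(S \ A) → ι) :
    Function.Injective fun f : A → ι => merge f g := by
  intro f f' hf
  funext j
  have := congrFun hf ⟨j, h j.2⟩
  simpa [merge] using this

/-- The slice of `ψ ∈ ⊗_{j ∈ S} 𝓗_j` over `A ⊆ S`, the sites in `S \ A` being in the basis
state `g`. Thus `ψ = ∑_g (slice of ψ at g) ⊗ (basis state g)`. -/
def slice {A S : Finset ℕ} (h : A ⊆ S) (g : ↥(S \ A) → ι) :
    TensorSpace ι S →ₗ[ℂ] TensorSpace ι A :=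
  pullback (fun f => merge f g) (merge_injective h g)

/-- The vacuum `⊗_{j ∈ S} Ω_j`. -/
def vacuum (Ω : 𝓗) (S : Finset ℕ) : TensorSpace ι S :=
  productVector b S fun _ => Ω

/-- The subspace `(⊗_{j ∈ A} ℂ Ω_j) ⊗ (⊗_{j ∈ S \ A} 𝓗_j)` of `⊗_{j ∈ S} 𝓗_j`: all slices over `A`
are multiples of the vacuum on `A`. -/
def vacuumSubspace (Ω : 𝓗) {A S : Finset ℕ} (h : A ⊆ S) : Submodule ℂ (TensorSpace ι S) :=
  ⨅ g : ↥(S \ A) → ι, (ℂ ∙ vacuum b Ω A).comap (slice h g)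

/-- `P⁽⁻⁾_A = ⊗_{j ∈ A} P_{Ω_j}` on `⊗_{j ∈ S} 𝓗_j`, the orthogonal projection onto
`vacuumSubspace` (which is closed, so that the closure changes nothing). -/
def projMinus (Ω : 𝓗) {A S : Finset ℕ} (h : A ⊆ S) : TensorSpace ι S →L[ℂ] TensorSpace ι S :=
  (vacuumSubspace b Ω h).topologicalClosure.starProjection

/-- `P⁽⁺⁾_A = 1 - P⁽⁻⁾_A`. -/
def projPlus (Ω : 𝓗) {A S : Finset ℕ} (h : A ⊆ S) : TensorSpace ι S →L[ℂ] TensorSpace ι S :=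
  1 - projMinus b Ω h

/-- `P⁽⁻⁾_S` on `⊗_{j ∈ S} 𝓗_j` itself: the projection onto the multiples of the vacuum. -/
abbrev vacuumProj (Ω : 𝓗) (S : Finset ℕ) : TensorSpace ι S →L[ℂ] TensorSpace ι S :=
  projMinus b Ω (Finset.Subset.refl S)

/-- `P⁽⁺⁾_S` on `⊗_{j ∈ S} 𝓗_j` itself. -/
abbrev vacuumProjCompl (Ω : 𝓗) (S : Finset ℕ) : TensorSpace ι S →L[ℂ] TensorSpace ι S :=
  projPlus b Ω (Finset.Subset.refl S)

/-! ### Potentials -/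

/-- The form domain `D((H⁰_S)^{1/2})`. -/
abbrev freeFormDomain (H : 𝓗 →ₗ.[ℂ] 𝓗) (S : Finset ℕ) : Submodule ℂ (TensorSpace ι S) :=
  formDomain (freeHamiltonian b H S)

/-- A potential with support `A`: a sesquilinear form on `D((H⁰_A)^{1/2})`. -/
abbrev Potential (H : 𝓗 →ₗ.[ℂ] 𝓗) (A : Finset ℕ) : Type v :=
  freeFormDomain b H A →ₗ⋆[ℂ] freeFormDomain b H A →ₗ[ℂ] ℂ

variable {b}

open Classical in
/-- The value `⟨φ, V ψ⟩` of a potential, for `φ, ψ ∈ D((H⁰_A)^{1/2})` (and `0` for other pairs). -/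
def Potential.eval {H : 𝓗 →ₗ.[ℂ] 𝓗} {A : Finset ℕ} (V : Potential b H A)
    (φ ψ : TensorSpace ι A) : ℂ :=
  if h : φ ∈ freeFormDomain b H A ∧ ψ ∈ freeFormDomain b H A then V ⟨φ, h.1⟩ ⟨ψ, h.2⟩ else 0

/-- The form of `V ⊗ 1` on `⊗_{j ∈ S} 𝓗_j`, where `V` has support `A ⊆ S`:
`⟨φ, (V ⊗ 1) ψ⟩ = ∑_g ⟨φ_g, V ψ_g⟩`, with the slices `φ_g, ψ_g` of `φ, ψ` over `A`. -/
def Potential.ampliation {H : 𝓗 →ₗ.[ℂ] 𝓗} {A S : Finset ℕ} (V : Potential b H A) (h : A ⊆ S)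
    (φ ψ : TensorSpace ι S) : ℂ :=
  ∑' g : ↥(S \ A) → ι, V.eval (slice h g φ) (slice h g ψ)

/-- The vacuum expectation `⟨V⟩ = ⟨⊗ Ω_j, V ⊗ Ω_j⟩` (a real number for symmetric `V`). -/
def Potential.expectation {H : 𝓗 →ₗ.[ℂ] 𝓗} {A : Finset ℕ} (V : Potential b H A) (Ω : 𝓗) : ℝ :=
  (V.eval (vacuum b Ω A) (vacuum b Ω A)).re

/-- `V` is symmetric. -/
def Potential.Symmetric {H : 𝓗 →ₗ.[ℂ] 𝓗} {A : Finset ℕ} (V : Potential b H A) : Prop :=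
  ∀ φ ψ : freeFormDomain b H A, V φ ψ = conj (V ψ φ)

/-- `V = P⁽⁺⁾_A V P⁽⁺⁾_A + P⁽⁻⁾_A V P⁽⁻⁾_A`. -/
def Potential.BlockDiagonal {H : 𝓗 →ₗ.[ℂ] 𝓗} {A : Finset ℕ} (V : Potential b H A) (Ω : 𝓗) :
    Prop :=
  ∀ φ ∈ freeFormDomain b H A, ∀ ψ ∈ freeFormDomain b H A,
    V.eval φ ψ =
      V.eval (vacuumProjCompl b Ω A φ) (vacuumProjCompl b Ω A ψ) +
      V.eval (vacuumProj b Ω A φ) (vacuumProj b Ω A ψ)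

/-- The weighted norm bound `‖(H⁰_A + 1)^{-1/2} V (H⁰_A + 1)^{-1/2}‖ ≤ c`: the form
`⟨(H⁰_A + 1)^{-1/2} φ, V (H⁰_A + 1)^{-1/2} ψ⟩` is given by a bounded operator of norm at most `c`. -/
def Potential.WeightedNormLE {H : 𝓗 →ₗ.[ℂ] 𝓗} {A : Finset ℕ} (V : Potential b H A) (c : ℝ) :
    Prop :=
  ∃ B : TensorSpace ι A →L[ℂ] TensorSpace ι A, ‖B‖ ≤ c ∧ ∀ φ ψ : TensorSpace ι A,
    V.eval (invSqrtAddOne (freeHamiltonian b H A) φ) (invSqrtAddOne (freeHamiltonian b H A) ψ)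
      = ⟪φ, B ψ⟫_ℂ

/-! ### The local Hamiltonians -/

/-- The interval `I_{k,q} = {q, …, q + k}`. -/
def interval (k q : ℕ) : Finset ℕ := Finset.Icc q (q + k)

/-- The index set of the intervals `I_{l,i} ⊂ I_{k,q}` with `1 ≤ l ≤ k - 1`. -/
def subIntervals (k q : ℕ) : Finset (ℕ × ℕ) :=
  (Finset.Icc 1 (k - 1) ×ˢ Finset.Icc q (q + k)).filter fun p => p.2 + p.1 ≤ q + k

theorem interval_subset {k q : ℕ} (p : subIntervals k q) :
    interval p.1.1 p.1.2 ⊆ interval k q := by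
  obtain ⟨⟨l, i⟩, hp⟩ := p
  simp only [subIntervals, Finset.mem_filter, Finset.mem_product, Finset.mem_Icc] at hp
  exact Finset.Icc_subset_Icc hp.1.2.1 hp.2

/-- The quadratic form, on `D((H⁰_{I_{k,q}})^{1/2})`, of
`G_{I_{k,q}} = ∑_{i ∈ I_{k,q}} H_i + t ∑_{l=1}^{k-1} ∑_{I_{l,i} ⊂ I_{k,q}} V_{I_{l,i}}`. -/
def localForm {H : 𝓗 →ₗ.[ℂ] 𝓗} (t : ℝ) (V : ∀ l i : ℕ, Potential b H (interval l i)) (k q : ℕ)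
    (φ ψ : TensorSpace ι (interval k q)) : ℂ :=
  opForm (freeHamiltonian b H (interval k q)) φ ψ +
    t * ∑ p : subIntervals k q, (V p.1.1 p.1.2).ampliation (interval_subset p) φ ψ

/-- `E_{I_{k,q}} = t ∑_{l=1}^{k-1} ∑_{I_{l,i} ⊂ I_{k,q}} ⟨V_{I_{l,i}}⟩`. -/
def localEnergy {H : 𝓗 →ₗ.[ℂ] 𝓗} (Ω : 𝓗) (t : ℝ)
    (V : ∀ l i : ℕ, Potential b H (interval l i)) (k q : ℕ) : ℝ :=
  t * ∑ p : subIntervals k q, (V p.1.1 p.1.2).expectation Ω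

/-- The potentials entering `G_{I_{k,q}}` are symmetric and already block-diagonalized, and they
obey the inductive bound `‖V_{I_{l,i}}‖_{H⁰} ≤ t^{(l-1)/4}`. -/
structure InductiveHypothesis {H : 𝓗 →ₗ.[ℂ] 𝓗} (Ω : 𝓗) (t : ℝ)
    (V : ∀ l i : ℕ, Potential b H (interval l i)) (k q : ℕ) : Prop where
  symmetric : ∀ p ∈ subIntervals k q, (V p.1 p.2).Symmetric
  blockDiagonal : ∀ p ∈ subIntervals k q, (V p.1 p.2).BlockDiagonal Ω
  bound : ∀ p ∈ subIntervals k q, (V p.1 p.2).WeightedNormLE (t ^ (((p.1 : ℝ) - 1) / 4))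

end Tensor

/-- The constant `1 - 8t - 4t ∑_{l=3}^∞ l t^{(l-2)/4}` (with `l = n + 3`). -/
def gapConstant (t : ℝ) : ℝ :=
  1 - 8 * t - 4 * t * ∑' n : ℕ, ((n + 3 : ℕ) : ℝ) * t ^ ((((n + 3 : ℕ) : ℝ) - 2) / 4)

end QuantumChain

end

open QuantumChain

/-! Every form is pulled back to a bounded operator. Let `K = (H⁰ + 1)^{-1/2}`, whose range is the
form domain. A form `g` becomes a bounded `L` with `g(K x, K y) = ⟨x, L y⟩`; for `H⁰` itself this is
`1 - K²`, so that `‖y‖² - ‖K y‖²` is the free energy of `K y`.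

One potential. Let `V` on `A` be given by `B` with `‖B‖ ≤ c`. Block-diagonality makes the vacuum an
eigenvector of `B` with eigenvalue `⟨V⟩ ≤ c`, so `V - ⟨V⟩` only sees the complement of the vacuum.
There `H⁰_A ≥ 1`, hence `V - ⟨V⟩ ≥ -c (H⁰_A + 1) - c ≥ -3c H⁰_A` (`Potential.operator_lower_bound`).

Many potentials. A site lies in at most `l + 1` intervals of length `l`, so summing `H⁰_A` over the
intervals costs at most `∑ (l + 1) t^{(l-1)/4}` copies of `H⁰`. With the factor `3t`, relaxed to
`4t`, this is the loss `1 - c(t)` (`sum_weights_le`), and `G - E ≥ c(t) H⁰` holds on the whole form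
domain (`exists_localForm_operator`). Restriction to the range of `P⁽⁺⁾`, which commutes with `K`,
gives the Lemma.

The Corollary. For small `t` one has `c(t) ≥ 1/2`. The operator `L` belonging to `G - E + 1` is then
coercive, so invertible, and `S = K L⁻¹ K` is the resolvent `(G - E + 1)⁻¹` of a self-adjoint `G`.
It fixes the vacuum and lies in `[0, 2/3]` on the complement, which is the gap `1/2`
(`exists_operator_of_form`).

Two facts about tensor products support this. `H⁰` on the intersection of the domains of the `H_i`
has a non-negative resolvent, obtained from the commuting one-site resolvents
(`exists_isResolvent_sum`). And `K` factors as `(1 ⊗ (H⁰_A + 1)^{-1/2}) T` with `T` bounded, which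
transports a potential from `A` to `S` (`IsSlicing.exists_factor`). -/

noncomputable section

namespace QuantumChain

section Resolvents

universe u
variable {E : Type u} [NormedAddCommGroup E] [InnerProductSpace ℂ E]

/-! ### Graphs and resolvents -/

theorem mem_graph_add_iff {A B : E →ₗ.[ℂ] E} {ψ η : E} :
    (ψ, η) ∈ (A + B).graph ↔
      ∃ a b, (ψ, a) ∈ A.graph ∧ (ψ, b) ∈ B.graph ∧ η = a + b := by
  constructor
  · intro h
    obtain ⟨x, hx, hη⟩ := (LinearPMap.mem_graph_iff _).1 h
    obtain ⟨x, hxA, hxB⟩ := x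
    subst hx
    exact ⟨A ⟨x, hxA⟩, B ⟨x, hxB⟩, LinearPMap.mem_graph _ ⟨x, hxA⟩,
      LinearPMap.mem_graph _ ⟨x, hxB⟩, hη.symm⟩
  · rintro ⟨a, b, ha, hb, rfl⟩
    obtain ⟨x, rfl, rfl⟩ := (LinearPMap.mem_graph_iff _).1 ha
    obtain ⟨y, hy, rfl⟩ := (LinearPMap.mem_graph_iff _).1 hb
    obtain ⟨x, hx⟩ := x
    obtain ⟨y, hy'⟩ := y
    dsimp only at hy
    subst hy
    exact LinearPMap.mem_graph (A + B) ⟨y, hx, hy'⟩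

theorem mem_graph_zero_iff {ψ η : E} : (ψ, η) ∈ (0 : E →ₗ.[ℂ] E).graph ↔ η = 0 := by
  rw [LinearPMap.mem_graph_iff]
  constructor
  · rintro ⟨y, -, h⟩
    exact h.symm
  · rintro rfl
    exact ⟨⟨ψ, trivial⟩, rfl, rfl⟩

theorem mem_graph_sum_iff {J : Type*} (A : J → E →ₗ.[ℂ] E) (s : Finset J) {ψ η : E} :
    (ψ, η) ∈ (∑ i ∈ s, A i).graph ↔
      ∃ a : J → E, (∀ i ∈ s, (ψ, a i) ∈ (A i).graph) ∧ η = ∑ i ∈ s, a i := by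
  classical
  induction s using Finset.induction_on generalizing η with
  | empty =>
    rw [Finset.sum_empty, mem_graph_zero_iff]
    simp
  | insert j s hj ih =>
    rw [Finset.sum_insert hj, mem_graph_add_iff]
    constructor
    · rintro ⟨a, c, ha, hc, rfl⟩
      obtain ⟨d, hd, rfl⟩ := ih.1 hc
      refine ⟨Function.update d j a, fun i hi => ?_, ?_⟩
      · obtain rfl | hi := Finset.mem_insert.1 hi
        · simpa using ha
        · rw [Function.update_of_ne (ne_of_mem_of_not_mem hi hj)]
          exact hd i hi
      · rw [Finset.sum_insert hj, Function.update_self]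
        congr 1
        refine Finset.sum_congr rfl fun i hi => ?_
        rw [Function.update_of_ne (ne_of_mem_of_not_mem hi hj)]
    · rintro ⟨a, ha, rfl⟩
      exact ⟨a j, ∑ i ∈ s, a i, ha j (Finset.mem_insert_self _ _),
        ih.2 ⟨a, fun i hi => ha i (Finset.mem_insert_of_mem hi), rfl⟩, Finset.sum_insert hj⟩

theorem IsResolvent.mem_graph_iff {A : E →ₗ.[ℂ] E} {R : E →L[ℂ] E} (h : IsResolvent A (-1) R)
    {ψ η : E} : (ψ, η) ∈ A.graph ↔ ψ = R (η + ψ) := by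
  rw [h (η + ψ) ψ]
  simp

theorem IsResolvent.of_mem_graph_iff {A : E →ₗ.[ℂ] E} {R : E →L[ℂ] E}
    (h : ∀ ψ η : E, (ψ, η) ∈ A.graph ↔ ψ = R (η + ψ)) : IsResolvent A (-1) R := by
  intro φ ψ
  rw [h]
  simp

theorem IsResolvent.apply_mem_graph {A : E →ₗ.[ℂ] E} {R : E →L[ℂ] E} (h : IsResolvent A (-1) R)
    (φ : E) : (R φ, φ - R φ) ∈ A.graph := by
  rw [h.mem_graph_iff]
  simp

theorem IsResolvent.injective {A : E →ₗ.[ℂ] E} {z : ℂ} {R : E →L[ℂ] E} (h : IsResolvent A z R) :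
    Function.Injective R := by
  refine (injective_iff_map_eq_zero R).2 fun x hx => ?_
  have := (h x 0).1 hx.symm
  simpa using LinearPMap.graph_fst_eq_zero_snd A this rfl

theorem IsResolvent.unique {A : E →ₗ.[ℂ] E} {z : ℂ} {R R' : E →L[ℂ] E} (h : IsResolvent A z R)
    (h' : IsResolvent A z R') : R = R' := by
  ext x
  exact (h' x (R x)).2 ((h x (R x)).1 rfl)

theorem IsResolvent.invAddOne_eq {A : E →ₗ.[ℂ] E} {R : E →L[ℂ] E} (h : IsResolvent A (-1) R) :
    invAddOne A = R := by
  have hex : ∃ R : E →L[ℂ] E, IsResolvent A (-1) R := ⟨R, h⟩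
  rw [invAddOne, dif_pos hex]
  exact hex.choose_spec.unique h

/-- `R` has the properties of `(A + 1)⁻¹` for a non-negative self-adjoint `A`: it is symmetric and
`R² ≤ R`. -/
structure IsNonnegResolvent (R : E →L[ℂ] E) : Prop where
  symm : ∀ x y : E, ⟪R x, y⟫_ℂ = ⟪x, R y⟫_ℂ
  sq_le : ∀ x : E, ‖R x‖ ^ 2 ≤ (⟪R x, x⟫_ℂ).re

theorem IsNonnegResolvent.nonneg {R : E →L[ℂ] E} (h : IsNonnegResolvent R) : 0 ≤ R := by
  rw [ContinuousLinearMap.nonneg_iff_isPositive, ContinuousLinearMap.isPositive_iff]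
  refine ⟨fun x y => h.symm x y, fun x => ?_⟩
  have h1 : conj ⟪R x, x⟫_ℂ = ⟪R x, x⟫_ℂ := by rw [inner_conj_symm, h.symm]
  rw [Complex.le_def]
  exact ⟨(sq_nonneg _).trans (h.sq_le x), (Complex.conj_eq_iff_im.1 h1).symm⟩

theorem IsNonnegResolvent.one : IsNonnegResolvent (1 : E →L[ℂ] E) where
  symm _ _ := rfl
  sq_le x := by
    have := inner_self_eq_norm_sq (𝕜 := ℂ) x
    simpa using this.symm.le

theorem re_inner_nonneg {T : E →L[ℂ] E} (h : 0 ≤ T) (x : E) : 0 ≤ (⟪T x, x⟫_ℂ).re := by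
  rw [ContinuousLinearMap.nonneg_iff_isPositive] at h
  exact h.re_inner_nonneg_left x

theorem isResolvent_zero : IsResolvent (0 : E →ₗ.[ℂ] E) (-1) 1 :=
  IsResolvent.of_mem_graph_iff fun ψ η => by
    rw [mem_graph_zero_iff]
    simp

/-- The operators `R = (A + 1)⁻¹` and `K = (A + 1)^{-1/2}` of a non-negative self-adjoint `A`. -/
structure IsResolventSqrt (A : E →ₗ.[ℂ] E) (R K : E →L[ℂ] E) : Prop where
  isResolvent : IsResolvent A (-1) R
  isNonneg : IsNonnegResolvent R
  nonneg : 0 ≤ K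
  mul_self : ∀ x, K (K x) = R x

namespace IsResolventSqrt

variable {A : E →ₗ.[ℂ] E} {R K : E →L[ℂ] E}

theorem symm (h : IsResolventSqrt A R K) (x y : E) : ⟪K x, y⟫_ℂ = ⟪x, K y⟫_ℂ :=
  ((ContinuousLinearMap.nonneg_iff_isPositive K).1 h.nonneg).inner_left_eq_inner_right x y

theorem injective (h : IsResolventSqrt A R K) : Function.Injective K := fun x y hxy =>
  h.isResolvent.injective (by rw [← h.mul_self, ← h.mul_self, hxy])

theorem norm_sq_apply (h : IsResolventSqrt A R K) (x : E) : ‖K x‖ ^ 2 = (⟪R x, x⟫_ℂ).re := by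
  rw [← h.mul_self, h.symm]
  exact (inner_self_eq_norm_sq (𝕜 := ℂ) _).symm

theorem norm_apply_le (h : IsResolventSqrt A R K) (x : E) : ‖K x‖ ≤ ‖x‖ := by
  have h1 : ‖R x‖ ≤ ‖x‖ := by
    have h2 := (h.isNonneg.sq_le x).trans (re_inner_le_norm (𝕜 := ℂ) (R x) x)
    rcases (norm_nonneg (R x)).eq_or_lt with h0 | h0
    · rw [← h0]; positivity
    · rw [sq] at h2
      exact le_of_mul_le_mul_left h2 h0
  have h3 := (h.norm_sq_apply x).le.trans (re_inner_le_norm (𝕜 := ℂ) (R x) x)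
  rw [← sq_le_sq₀ (norm_nonneg _) (norm_nonneg _)]
  nlinarith [norm_nonneg x]

end IsResolventSqrt

/-! ### Sums of commuting non-negative operators -/

variable [CompleteSpace E]

theorem denseRange_of_symm_of_injective {R : E →L[ℂ] E}
    (hs : ∀ x y : E, ⟪R x, y⟫_ℂ = ⟪x, R y⟫_ℂ) (hi : Function.Injective R) : DenseRange R := by
  have : Dense ((LinearMap.range (R : E →ₗ[ℂ] E) : Submodule ℂ E) : Set E) := by
    rw [Submodule.dense_iff_topologicalClosure_eq_top, Submodule.topologicalClosure_eq_top_iff,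
      Submodule.eq_bot_iff]
    intro x hx
    refine (injective_iff_map_eq_zero R).1 hi x (ext_inner_left ℂ fun y => ?_)
    rw [← hs, inner_zero_right]
    exact hx (R y) ⟨y, rfl⟩
  exact this

theorem exists_extension {F : Type*} [NormedAddCommGroup F] [NormedSpace ℂ F]
    {G : Type*} [NormedAddCommGroup G] [NormedSpace ℂ G] (f : G →L[ℂ] E) (e : G →L[ℂ] F)
    (he : DenseRange e) (C : ℝ) (h : ∀ x, ‖f x‖ ≤ C * ‖e x‖) :
    ∃ X : F →L[ℂ] E, ∀ x, X (e x) = f x :=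
  ⟨(f : G →ₗ[ℂ] E).extendOfNorm (e : G →ₗ[ℂ] F), fun x =>
    LinearMap.extendOfNorm_eq (f := (f : G →ₗ[ℂ] E)) (e := (e : G →ₗ[ℂ] F)) he ⟨C, h⟩ x⟩

/-- For commuting resolvents `R`, `R'` of non-negative operators, `R² ≤ (R + R' - R R')²`. -/
theorem norm_le_norm_add_sub_mul {R R' : E →L[ℂ] E} (h : IsNonnegResolvent R)
    (h' : IsNonnegResolvent R') (hc : Commute R R') (x : E) :
    ‖R x‖ ≤ ‖(R + R' - R * R') x‖ := by
  -- Writing the operator as `R + R' (1 - R)`, the cross term in the squared norm is `⟨R (1 - R) R'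
  -- x, x⟩`, which is non-negative as a product of commuting non-negative operators.
  have hp : 0 ≤ R * (1 - R) := by
    rw [ContinuousLinearMap.nonneg_iff_isPositive, ContinuousLinearMap.isPositive_iff]
    have hs : ∀ x y : E, ⟪(R * (1 - R)) x, y⟫_ℂ = ⟪x, (R * (1 - R)) y⟫_ℂ := fun x y => by
      simp [h.symm]
    refine ⟨hs, fun x => ?_⟩
    have h1 : conj ⟪(R * (1 - R)) x, x⟫_ℂ = ⟪(R * (1 - R)) x, x⟫_ℂ := by
      rw [inner_conj_symm, hs]
    rw [Complex.le_def]
    refine ⟨?_, (Complex.conj_eq_iff_im.1 h1).symm⟩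
    have h2 := h.sq_le x
    have h3 := inner_self_eq_norm_sq (𝕜 := ℂ) (R x)
    simp only [mul_apply_eq_comp, sub_apply,
      one_apply_eq_self, map_sub, inner_sub_left, Complex.sub_re, Complex.zero_re]
    rw [h.symm (R x)]
    have : (⟪R x, R x⟫_ℂ).re = ‖R x‖ ^ 2 := h3
    linarith
  have hcomm : Commute (R * (1 - R)) R' :=
    Commute.mul_left hc ((Commute.one_left _).sub_left hc)
  have h1 := re_inner_nonneg (Commute.mul_nonneg hp h'.nonneg hcomm) x
  have h2 : (R + R' - R * R') x = R x + R' (x - R x) := by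
    have : R (R' x) = R' (R x) := congrArg (fun T : E →L[ℂ] E => T x) hc.eq
    simp only [sub_apply, add_apply,
      mul_apply_eq_comp, map_sub, this]
    abel
  have h3 : (⟪R x, R' (x - R x)⟫_ℂ).re = (⟪(R * (1 - R) * R') x, x⟫_ℂ).re := by
    have h4 : R (R' (x - R x)) = (R * (1 - R) * R') x := by
      have h5 : ∀ y, R (R' y) = R' (R y) := fun y => congrArg (fun T : E →L[ℂ] E => T y) hc.eq
      simp [h5]
    rw [h.symm, h4, ← inner_conj_symm, Complex.conj_re]
  rw [← sq_le_sq₀ (norm_nonneg _) (norm_nonneg _), h2, norm_add_sq (𝕜 := ℂ)]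
  have h4 : 0 ≤ RCLike.re ⟪R x, R' (x - R x)⟫_ℂ := h1.trans_eq h3.symm
  nlinarith [sq_nonneg ‖R' (x - R x)‖]

/-- The sum of two commuting non-negative self-adjoint operators, on the intersection of their
domains, is again such an operator. -/
theorem exists_isResolvent_add {A B : E →ₗ.[ℂ] E} {R R' : E →L[ℂ] E}
    (hA : IsResolvent A (-1) R) (hB : IsResolvent B (-1) R') (h : IsNonnegResolvent R)
    (h' : IsNonnegResolvent R') (hc : Commute R R') :
    ∃ C : E →L[ℂ] E, IsResolvent (A + B) (-1) C ∧ IsNonnegResolvent C ∧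
      ∀ T : E →L[ℂ] E, Commute T R → Commute T R' → Commute T C := by
  -- For numbers, `r = 1/(a+1)` and `r' = 1/(b+1)` give `1/(a+b+1) = r r' / (r + r' - r r')`. Here
  -- `M` is the denominator, and `X`, `Y` below play the roles of `R M⁻¹`, `R' M⁻¹`; they are
  -- bounded because `R²` and `R'²` are at most `M²`.
  set M : E →L[ℂ] E := R + R' - R * R' with hM
  have hcx : ∀ x, R (R' x) = R' (R x) := fun x => congrArg (fun T : E →L[ℂ] E => T x) hc.eq
  have hMx : ∀ x, M x = R x + R' x - R (R' x) := fun x => by simp [hM]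
  have hMR : ∀ x, M (R x) = R (M x) := fun x => by simp [hMx, hcx]
  have hMR' : ∀ x, M (R' x) = R' (M x) := fun x => by simp [hMx, hcx]
  have hle : ∀ x, ‖R x‖ ≤ ‖M x‖ := norm_le_norm_add_sub_mul h h' hc
  have hle' : ∀ x, ‖R' x‖ ≤ ‖M x‖ := fun x => by
    have := norm_le_norm_add_sub_mul h' h hc.symm x
    rwa [add_comm R' R, ← hc.eq] at this
  have hMinj : Function.Injective M := (injective_iff_map_eq_zero M).2 fun x hx =>
    (injective_iff_map_eq_zero R).1 hA.injective x (norm_le_zero_iff.1 (by simpa [hx] using hle x))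
  have hMs : ∀ x y, ⟪M x, y⟫_ℂ = ⟪x, M y⟫_ℂ := fun x y => by
    simp only [hMx, inner_sub_left, inner_add_left, inner_sub_right, inner_add_right, h.symm,
      h'.symm]
    rw [hcx y]
  have hMd : DenseRange M := denseRange_of_symm_of_injective hMs hMinj
  obtain ⟨X, hX⟩ := exists_extension R M hMd 1 (by simpa using hle)
  obtain ⟨Y, hY⟩ := exists_extension R' M hMd 1 (by simpa using hle')
  have heq : ∀ {f g : E → E}, Continuous f → Continuous g → (∀ x, f (M x) = g (M x)) →
      ∀ x, f x = g x := fun hf hg hfg =>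
    congrFun (hMd.equalizer hf hg (funext hfg))
  have hMX : ∀ x, M (X x) = R x :=
    heq (by fun_prop) (by fun_prop) fun x => by rw [hX, hMR]
  have hMY : ∀ x, M (Y x) = R' x :=
    heq (by fun_prop) (by fun_prop) fun x => by rw [hY, hMR']
  have hC1 : ∀ x, X (R' x) = R' (X x) := fun x => hMinj (by rw [hMX, hMR', hMX, hcx])
  have hC2 : ∀ x, X (R' x) = R (Y x) := fun x => hMinj (by rw [hMX, hMR, hMY])
  have hMC : ∀ x, M (X (R' x)) = R (R' x) := fun x => hMX _
  have hXY : ∀ x, X x + Y x - X (R' x) = x := fun x => hMinj (by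
    rw [map_sub, map_add, hMX, hMY, hMX, hMx])
  have hgraph : ∀ ψ η : E, (ψ, η) ∈ (A + B).graph ↔ ψ = X (R' (η + ψ)) := by
    intro ψ η
    rw [mem_graph_add_iff]
    constructor
    · rintro ⟨a, b, ha, hb, rfl⟩
      rw [hA.mem_graph_iff] at ha
      rw [hB.mem_graph_iff] at hb
      refine hMinj ?_
      rw [hMC]
      have e : a + b + ψ = (a + ψ) + (b + ψ) - ψ := by abel
      rw [e, map_sub, map_sub, map_add, map_add, ← hb, hcx, ← ha, hMx]
      abel
    · intro hψ
      -- Formally `A ψ = R⁻¹ ψ - ψ` and `ψ = R Y (η + ψ)`; similarly for `B`.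
      refine ⟨Y (η + ψ) - ψ, X (η + ψ) - ψ, ?_, ?_, ?_⟩
      · rw [hA.mem_graph_iff, sub_add_cancel, ← hC2, ← hψ]
      · rw [hB.mem_graph_iff, sub_add_cancel, ← hC1, ← hψ]
      · have := hXY (η + ψ)
        rw [← hψ] at this
        have e : Y (η + ψ) - ψ + (X (η + ψ) - ψ) = X (η + ψ) + Y (η + ψ) - ψ - ψ := by abel
        rw [e, this]
        abel
  -- Inserting `y = X y + Y y - X R' y` and `X R' = R Y = R' X` yields an expression whose symmetry
  -- is visible, and which reduces `C² ≤ C` to `R² ≤ R` and `R'² ≤ R'`.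
  have e : ∀ x y, ⟪X (R' x), y⟫_ℂ =
      ⟪R (Y x), Y y⟫_ℂ + ⟪R' (X x), X y⟫_ℂ - ⟪X (R' x), X (R' y)⟫_ℂ := fun x y => by
    nth_rewrite 1 [← hXY y]
    rw [inner_sub_right, inner_add_right, ← hC2, ← hC1]
    ring
  refine ⟨X * R', IsResolvent.of_mem_graph_iff hgraph, ⟨fun x y => ?_, fun x => ?_⟩, ?_⟩
  · simp only [mul_apply_eq_comp]
    rw [e x y, ← inner_conj_symm x, e y x, map_sub, map_add, inner_conj_symm, inner_conj_symm,
      inner_conj_symm, h.symm, h'.symm]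
  · simp only [mul_apply_eq_comp]
    have h1 := h.sq_le (Y x)
    have h2 := h'.sq_le (X x)
    rw [← hC2] at h1
    rw [← hC1] at h2
    have h3 : (⟪X (R' x), X (R' x)⟫_ℂ).re = ‖X (R' x)‖ ^ 2 := inner_self_eq_norm_sq (𝕜 := ℂ) _
    rw [e, Complex.sub_re, Complex.add_re, h3, ← hC2, ← hC1]
    linarith
  · intro T hT hT'
    have hTx : ∀ x, T (R x) = R (T x) := fun x => congrArg (fun S : E →L[ℂ] E => S x) hT.eq
    have hTx' : ∀ x, T (R' x) = R' (T x) := fun x => congrArg (fun S : E →L[ℂ] E => S x) hT'.eq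
    have hTM : ∀ x, T (M x) = M (T x) := fun x => by simp [hMx, hTx, hTx']
    ext x
    exact hMinj (by simp [← hTM, hMX, hTx, hTx'])

/-- The sum of finitely many commuting non-negative self-adjoint operators, on the intersection of
their domains, is again such an operator. -/
theorem exists_isResolvent_sum {J : Type*} (A : J → E →ₗ.[ℂ] E) (R : J → E →L[ℂ] E)
    (hA : ∀ i, IsResolvent (A i) (-1) (R i)) (h : ∀ i, IsNonnegResolvent (R i))
    (hc : ∀ i j, Commute (R i) (R j)) (s : Finset J) :
    ∃ C : E →L[ℂ] E, IsResolvent (∑ i ∈ s, A i) (-1) C ∧ IsNonnegResolvent C ∧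
      ∀ T : E →L[ℂ] E, (∀ i, Commute T (R i)) → Commute T C := by
  classical
  induction s using Finset.induction_on with
  | empty => exact ⟨1, isResolvent_zero, IsNonnegResolvent.one, fun T _ => Commute.one_right T⟩
  | insert j s hj ih =>
    obtain ⟨C, hC, hC', hcomm⟩ := ih
    obtain ⟨D, hD, hD', hDcomm⟩ :=
      exists_isResolvent_add (hA j) hC (h j) hC' (hcomm _ fun i => hc j i)
    refine ⟨D, ?_, hD', fun T hT => hDcomm T (hT j) (hcomm T hT)⟩
    rwa [Finset.sum_insert hj]

/-! ### Self-adjoint operators -/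

theorem _root_.IsSelfAdjoint.mem_graph_iff {A : E →ₗ.[ℂ] E} (hA : IsSelfAdjoint A) {ψ η : E} :
    (ψ, η) ∈ A.graph ↔ ∀ a b, (a, b) ∈ A.graph → ⟪b, ψ⟫_ℂ = ⟪a, η⟫_ℂ := by
  have h := LinearPMap.adjoint_graph_eq_graph_adjoint hA.dense_domain
  rw [LinearPMap.isSelfAdjoint_def.1 hA] at h
  nth_rewrite 1 [h]
  rw [Submodule.mem_adjoint_iff]
  simp only [sub_eq_zero]

theorem isSelfAdjoint_of_mem_graph_iff {A : E →ₗ.[ℂ] E} (hd : Dense (A.domain : Set E))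
    (hA : ∀ ψ η, (ψ, η) ∈ A.graph ↔ ∀ a b, (a, b) ∈ A.graph → ⟪b, ψ⟫_ℂ = ⟪a, η⟫_ℂ) :
    IsSelfAdjoint A := by
  rw [LinearPMap.isSelfAdjoint_def]
  refine LinearPMap.eq_of_eq_graph ?_
  rw [LinearPMap.adjoint_graph_eq_graph_adjoint hd]
  ext ⟨ψ, η⟩
  rw [hA, Submodule.mem_adjoint_iff]
  simp only [sub_eq_zero]

/-- A non-negative self-adjoint operator has a resolvent at `-1`. -/
theorem exists_isResolvent_of_isSelfAdjoint {A : E →ₗ.[ℂ] E} (hA : IsSelfAdjoint A)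
    (hn : ∀ ψ : A.domain, 0 ≤ (⟪(ψ : E), A ψ⟫_ℂ).re) :
    ∃ R : E →L[ℂ] E, IsResolvent A (-1) R ∧ IsNonnegResolvent R := by
  have hn' : ∀ {ψ η : E}, (ψ, η) ∈ A.graph → 0 ≤ (⟪ψ, η⟫_ℂ).re := by
    intro ψ η h
    obtain ⟨x, rfl, rfl⟩ := (LinearPMap.mem_graph_iff _).1 h
    exact hn x
  have hbd : ∀ {ψ η : E}, (ψ, η) ∈ A.graph → ‖ψ‖ ^ 2 ≤ (⟪ψ, η + ψ⟫_ℂ).re := by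
    intro ψ η h
    have h1 : (⟪ψ, ψ⟫_ℂ).re = ‖ψ‖ ^ 2 := inner_self_eq_norm_sq (𝕜 := ℂ) _
    rw [inner_add_right, Complex.add_re, h1]
    linarith [hn' h]
  have hbd' : ∀ {ψ η : E}, (ψ, η) ∈ A.graph → ‖ψ‖ ≤ ‖η + ψ‖ := by
    intro ψ η h
    have h1 := (hbd h).trans (re_inner_le_norm (𝕜 := ℂ) ψ (η + ψ))
    rcases (norm_nonneg ψ).eq_or_lt with h0 | h0
    · rw [← h0]; positivity
    · rw [sq] at h1
      exact le_of_mul_le_mul_left h1 h0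
  have hcl : IsClosed (A.graph : Set (E × E)) := hA.isClosed
  have : CompleteSpace A.graph := hcl.completeSpace_coe
  -- the map `(ψ, Aψ) ↦ Aψ + ψ` is bijective from the graph onto the space
  let S : A.graph →L[ℂ] E :=
    (ContinuousLinearMap.snd ℂ E E + ContinuousLinearMap.fst ℂ E E).comp A.graph.subtypeL
  have hS : ∀ x : A.graph, S x = x.1.2 + x.1.1 := fun x => rfl
  have hanti : AntilipschitzWith 2 S := by
    refine ContinuousLinearMap.antilipschitz_of_bound _ fun x => ?_
    obtain ⟨⟨ψ, η⟩, hx⟩ := x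
    have h1 := hbd' hx
    have h2 : ‖η‖ ≤ ‖η + ψ‖ + ‖ψ‖ := by simpa using norm_sub_le (η + ψ) ψ
    rw [hS]
    change ‖(ψ, η)‖ ≤ 2 * ‖η + ψ‖
    rw [Prod.norm_def]
    refine max_le ?_ ?_ <;> dsimp only <;> linarith [norm_nonneg ψ]
  have hrange : S.range = ⊤ := by
    have hclr : IsClosed (S.range : Set E) := hanti.isClosed_range S.uniformContinuous
    rw [← hclr.submodule_topologicalClosure_eq, Submodule.topologicalClosure_eq_top_iff,
      Submodule.eq_bot_iff]
    intro y hy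
    -- Orthogonality to the range of `A + 1` says that `A* y = -y`, and `A* = A`; the bound `‖ψ‖ ≤
    -- ‖A ψ + ψ‖` then gives `y = 0`.
    have h1 : (y, -y) ∈ A.graph := by
      rw [hA.mem_graph_iff]
      intro a b hab
      have h2 : ⟪b + a, y⟫_ℂ = 0 := hy _ ⟨⟨(a, b), hab⟩, rfl⟩
      rw [inner_add_left] at h2
      rw [inner_neg_right]
      exact eq_neg_of_add_eq_zero_left h2
    have h3 := hbd' h1
    simpa using h3
  let e := ContinuousLinearEquiv.ofBijective S
    (LinearMap.ker_eq_bot.2 hanti.injective) hrange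
  have he : ∀ x, e x = S x := fun x => rfl
  refine ⟨((ContinuousLinearMap.fst ℂ E E).comp A.graph.subtypeL).comp
    (e.symm : E →L[ℂ] A.graph), ?_, ?_⟩
  all_goals
    set R : E →L[ℂ] E := ((ContinuousLinearMap.fst ℂ E E).comp A.graph.subtypeL).comp
      (e.symm : E →L[ℂ] A.graph) with hR
    have hgr : ∀ ψ η : E, (ψ, η) ∈ A.graph ↔ ψ = R (η + ψ) := by
      intro ψ η
      constructor
      · intro h
        have h1 : e ⟨(ψ, η), h⟩ = η + ψ := rfl
        rw [← h1]
        simp [hR]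
      · intro h
        have h1 := he (e.symm (η + ψ))
        rw [e.apply_symm_apply, hS] at h1
        have h2 : (e.symm (η + ψ)).1.1 = ψ := h.symm
        have h3 : (e.symm (η + ψ)).1.2 = η := by
          rw [h2] at h1
          exact (add_right_cancel h1).symm
        have h4 := (e.symm (η + ψ)).2
        rwa [← Prod.mk.eta (p := (e.symm (η + ψ)).1), h2, h3] at h4
    have hres := IsResolvent.of_mem_graph_iff hgr
  · exact hres
  · refine ⟨fun x y => ?_, fun x => ?_⟩
    · have h1 := (hA.mem_graph_iff).1 (hres.apply_mem_graph y) _ _ (hres.apply_mem_graph x)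
      rw [inner_sub_left, inner_sub_right] at h1
      linear_combination -h1
    · simpa using hbd (hres.apply_mem_graph x)

/-! ### Form domains and forms -/

theorem exists_isResolventSqrt {A : E →ₗ.[ℂ] E} {R : E →L[ℂ] E} (h : IsResolvent A (-1) R)
    (hn : IsNonnegResolvent R) : ∃ K, IsResolventSqrt A R K :=
  ⟨CFC.sqrt R, h, hn, CFC.sqrt_nonneg R, fun x =>
    congrArg (fun T : E →L[ℂ] E => T x) (CFC.sqrt_mul_sqrt_self R hn.nonneg)⟩

namespace IsResolventSqrt

variable {A : E →ₗ.[ℂ] E} {R K : E →L[ℂ] E}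

theorem invSqrtAddOne_eq (h : IsResolventSqrt A R K) : invSqrtAddOne A = K := by
  rw [invSqrtAddOne, h.isResolvent.invAddOne_eq]
  exact CFC.sqrt_unique (ContinuousLinearMap.ext h.mul_self) h.nonneg

theorem denseRange (h : IsResolventSqrt A R K) : DenseRange K := denseRange_of_symm_of_injective h.symm h.injective

theorem mem_formDomain_iff (h : IsResolventSqrt A R K) {ψ : E} : ψ ∈ formDomain A ↔ ∃ x, K x = ψ := by
  rw [formDomain, h.invSqrtAddOne_eq]
  exact LinearMap.mem_range

theorem apply_mem_formDomain (h : IsResolventSqrt A R K) (x : E) : K x ∈ formDomain A := h.mem_formDomain_iff.2 ⟨x, rfl⟩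

theorem opForm_apply (h : IsResolventSqrt A R K) (x y : E) : opForm A (K x) (K y) = ⟪x, y⟫_ℂ - ⟪K x, K y⟫_ℂ := by
  have hker : ((K : E →ₗ[ℂ] E).toPMap ⊤).toFun.ker = ⊥ := by
    rw [LinearMap.ker_eq_bot]
    intro a b hab
    exact Subtype.ext (h.injective hab)
  have hdom : ∀ x, K x ∈ (sqrtAddOne A).domain := fun x => by
    rw [sqrtAddOne, h.invSqrtAddOne_eq, LinearPMap.inverse_domain]
    exact ⟨⟨x, trivial⟩, rfl⟩
  have hap : ∀ x, sqrtAddOne A ⟨K x, hdom x⟩ = x := fun x => by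
    have hg : (K x, x) ∈ (sqrtAddOne A).graph := by
      rw [sqrtAddOne, h.invSqrtAddOne_eq]
      exact LinearPMap.mem_inverse_graph hker ⟨x, trivial⟩
    obtain ⟨y, hy, hy'⟩ := (LinearPMap.mem_graph_iff _).1 hg
    refine Eq.trans ?_ hy'
    congr 1
    exact Subtype.ext hy.symm
  rw [opForm, dif_pos ⟨hdom x, hdom y⟩, hap, hap]

end IsResolventSqrt

end Resolvents

/-! ### From a coercive form to a self-adjoint operator with a spectral gap -/

section OperatorOfForm

universe u
variable {E : Type u} [NormedAddCommGroup E] [InnerProductSpace ℂ E] [CompleteSpace E]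

/-- A bounded symmetric injective operator `S` is the resolvent `(G + a)⁻¹` of a self-adjoint
operator `G`. -/
theorem exists_isSelfAdjoint_of_symm {S : E →L[ℂ] E} (hs : ∀ x y : E, ⟪S x, y⟫_ℂ = ⟪x, S y⟫_ℂ)
    (hi : Function.Injective S) (a : ℝ) :
    ∃ G : E →ₗ.[ℂ] E, IsSelfAdjoint G ∧
      ∀ ψ η : E, (ψ, η) ∈ G.graph ↔ ψ = S (η + (a : ℂ) • ψ) := by
  let g : Submodule ℂ (E × E) := LinearMap.eqLocus (LinearMap.fst ℂ E E)
    ((S : E →ₗ[ℂ] E) ∘ₗ (LinearMap.snd ℂ E E + (a : ℂ) • LinearMap.fst ℂ E E))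
  have hg : ∀ ψ η : E, (ψ, η) ∈ g ↔ ψ = S (η + (a : ℂ) • ψ) := fun ψ η => Iff.rfl
  have hgr : g.toLinearPMap.graph = g := by
    refine Submodule.toLinearPMap_graph_eq g ?_
    rintro ⟨ψ, η⟩ hx hψ
    dsimp only at hψ ⊢
    subst hψ
    rw [hg, smul_zero, add_zero] at hx
    exact (injective_iff_map_eq_zero S).1 hi η hx.symm
  have hG : ∀ ψ η : E, (ψ, η) ∈ g.toLinearPMap.graph ↔ ψ = S (η + (a : ℂ) • ψ) := by
    intro ψ η
    rw [hgr, hg]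
  have hmem : ∀ x, (S x, x - (a : ℂ) • S x) ∈ g.toLinearPMap.graph := fun x => by
    rw [hG, sub_add_cancel]
  refine ⟨g.toLinearPMap, isSelfAdjoint_of_mem_graph_iff ?_ fun ψ η => ?_, hG⟩
  · refine Dense.mono ?_ (denseRange_of_symm_of_injective hs hi)
    rintro _ ⟨x, rfl⟩
    exact LinearPMap.mem_domain_of_mem_graph (hmem x)
  · constructor
    · intro h α β hαβ
      rw [hG] at h hαβ
      have h1 := hs (β + (a : ℂ) • α) (η + (a : ℂ) • ψ)
      rw [← h, ← hαβ, inner_add_left, inner_add_right, inner_smul_left, inner_smul_right,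
        Complex.conj_ofReal] at h1
      linear_combination -h1
    · intro h
      rw [hG]
      refine ext_inner_left ℂ fun x => ?_
      have h1 := h _ _ (hmem x)
      rw [inner_sub_left, inner_smul_left, Complex.conj_ofReal] at h1
      rw [← hs, inner_add_right, inner_smul_right]
      linear_combination h1

/-- A zero of `1 - w τ` on `[0, 2/3]` would force `w = 1/τ` to be real and at least `3/2`;
compactness turns non-vanishing into a uniform bound. -/
theorem exists_lower_bound_one_sub_mul {w : ℂ} (hw : ∀ r : ℝ, w = r → r < 3 / 2) :
    ∃ c : ℝ, 0 < c ∧ ∀ τ : ℝ, 0 ≤ τ → τ ≤ 2 / 3 → c ≤ ‖1 - w * τ‖ := by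
  have hne : (Set.Icc (0 : ℝ) (2 / 3)).Nonempty := ⟨0, by norm_num⟩
  have hcont : Continuous fun τ : ℝ => ‖1 - w * τ‖ := by fun_prop
  obtain ⟨τ₀, hτ₀, hmin⟩ := isCompact_Icc.exists_isMinOn hne hcont.continuousOn
  refine ⟨‖1 - w * τ₀‖, ?_, fun τ h0 h1 => hmin ⟨h0, h1⟩⟩
  rw [norm_pos_iff]
  intro h
  have h0 : τ₀ ≠ 0 := by
    rintro rfl
    simp at h
  have h1 : w = ((τ₀⁻¹ : ℝ) : ℂ) := by
    have : (τ₀ : ℂ) ≠ 0 := by exact_mod_cast h0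
    push_cast
    field_simp
    linear_combination -h
  have h2 := hw _ h1
  have h3 : 0 < τ₀ := lt_of_le_of_ne hτ₀.1 (Ne.symm h0)
  have h4 : (3 / 2 : ℝ) ≤ τ₀⁻¹ := by
    rw [le_inv_comm₀ (by norm_num) h3]
    exact hτ₀.2.trans_eq (by norm_num)
  linarith

/-- If `S = (G - e + 1)⁻¹` fixes the unit vector `Ω` and lies between `0` and `2/3` on its
orthogonal complement, then `G` has a resolvent at every `z` other than `e` and the reals
`≥ e + 1/2`. -/
theorem exists_isResolvent_of_gap {G : E →ₗ.[ℂ] E} {S : E →L[ℂ] E} {e : ℝ}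
    (hs : ∀ x y : E, ⟪S x, y⟫_ℂ = ⟪x, S y⟫_ℂ)
    (hG : ∀ ψ η : E, (ψ, η) ∈ G.graph ↔ ψ = S (η + ((1 - e : ℝ) : ℂ) • ψ))
    {Ω : E} (hΩ : ‖Ω‖ = 1) (hSΩ : S Ω = Ω)
    (hS : ∀ x, ⟪Ω, x⟫_ℂ = 0 → 3 / 2 * ‖S x‖ ^ 2 ≤ (⟪S x, x⟫_ℂ).re)
    {z : ℂ} (hz : z ≠ e) (hz' : ∀ r : ℝ, z = r → r < e + 1 / 2) :
    ∃ R : E →L[ℂ] E, IsResolvent G z R := by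
  let P : E →L[ℂ] E := (innerSL ℂ Ω).smulRight Ω
  have hP : ∀ x, P x = ⟪Ω, x⟫_ℂ • Ω := fun x => rfl
  have hPP : ∀ x, P (P x) = P x := fun x => by simp [hP, hΩ]
  have hSP : ∀ x, S (P x) = P x := fun x => by simp [hP, hSΩ]
  have hPS : ∀ x, P (S x) = P x := fun x => by rw [hP, hP, ← hs, hSΩ]
  have hPorth : ∀ x, ⟪Ω, x - P x⟫_ℂ = 0 := fun x => by
    simp [hP, hΩ]
  -- `T` is the part of `S` on the complement of `Ω`; its numerical range will be seen to lie in
  -- `[0, 2/3]`.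
  let T : E →L[ℂ] E := S - P
  have hT : ∀ x, T x = S x - P x := fun x => rfl
  have hTP : ∀ x, T (P x) = 0 := fun x => by rw [hT, hSP, hPP, sub_self]
  have hPT : ∀ x, P (T x) = 0 := fun x => by rw [hT, map_sub, hPS, hPP, sub_self]
  have hPs : ∀ x y, ⟪P x, y⟫_ℂ = ⟪x, P y⟫_ℂ := fun x y => by
    simp [hP]
  -- In terms of `S`, the equation `(G - z) ψ = φ` reads `ψ = S (φ + w ψ)`. The excluded values `z =
  -- e` and `z ≥ e + 1/2` become `w = 1` and `w ≥ 3/2`.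
  set w : ℂ := z + (1 - e : ℝ) with hw
  have hw1 : 1 - w ≠ 0 := by
    intro h
    apply hz
    rw [hw] at h
    push_cast at h
    linear_combination -h
  have hw2 : ∀ r : ℝ, w = r → r < 3 / 2 := by
    intro r hr
    have := hz' (r - 1 + e) (by
      push_cast
      rw [hw] at hr
      push_cast at hr
      linear_combination hr)
    linarith
  obtain ⟨c, hc, hbd⟩ := exists_lower_bound_one_sub_mul hw2
  have hTx : ∀ x, ∃ τ : ℝ, 0 ≤ τ ∧ τ ≤ 2 / 3 ∧ ⟪T x, x⟫_ℂ = τ * ‖x‖ ^ 2 := by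
    intro x
    rcases eq_or_ne x 0 with rfl | hx
    · exact ⟨0, le_rfl, by norm_num, by simp⟩
    have hx' : 0 < ‖x‖ := norm_pos_iff.2 hx
    set y := x - P x with hy
    have h1 : ⟪T x, x⟫_ℂ = ⟪S y, y⟫_ℂ := by
      have e1 : T x = S y := by rw [hy, map_sub, hSP, hT]
      have e2 : ⟪S y, P x⟫_ℂ = 0 := by rw [← e1, ← hPs, hPT, inner_zero_left]
      rw [e1]
      nth_rewrite 3 [hy]
      rw [inner_sub_right, e2, sub_zero]
    have h2 : conj ⟪S y, y⟫_ℂ = ⟪S y, y⟫_ℂ := by rw [inner_conj_symm, hs]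
    have h3 : ((⟪S y, y⟫_ℂ).re : ℂ) = ⟪S y, y⟫_ℂ := Complex.conj_eq_iff_re.1 h2
    have h4 := hS y (hPorth x)
    have h5 : (⟪S y, y⟫_ℂ).re ≤ ‖S y‖ * ‖y‖ := re_inner_le_norm (𝕜 := ℂ) _ _
    have h6 : ‖y‖ ^ 2 ≤ ‖x‖ ^ 2 := by
      have h8 : ‖x‖ ^ 2 = ‖P x + y‖ ^ 2 := by rw [hy, add_sub_cancel]
      have h7 : ⟪P x, y⟫_ℂ = 0 := by rw [hP, inner_smul_left, hPorth, mul_zero]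
      rw [h8, norm_add_sq (𝕜 := ℂ), h7, map_zero, mul_zero, add_zero]
      exact le_add_of_nonneg_left (sq_nonneg _)
    -- From `3/2 ‖S y‖² ≤ ⟨S y, y⟩ ≤ ‖S y‖ ‖y‖` one gets `‖S y‖ ≤ 2/3 ‖y‖`.
    have h8 : (⟪S y, y⟫_ℂ).re ≤ 2 / 3 * ‖x‖ ^ 2 := by
      nlinarith [sq_nonneg (‖S y‖ - 2 / 3 * ‖y‖)]
    refine ⟨(⟪S y, y⟫_ℂ).re / ‖x‖ ^ 2, ?_, ?_, ?_⟩
    · have : 0 ≤ (⟪S y, y⟫_ℂ).re := le_trans (by positivity) h4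
      positivity
    · rwa [div_le_iff₀ (by positivity)]
    · rw [h1, ← h3]
      have : (‖x‖ : ℂ) ≠ 0 := by exact_mod_cast hx'.ne'
      push_cast
      field_simp
      simp
  -- Lax–Milgram: the numerical range of `1 - w T` stays at distance at least `c` from `0`.
  have hU : IsUnit (1 - w • T) := by
    refine ContinuousLinearMap.isUnit_of_forall_le_norm_inner_map _ (c := ⟨c, hc.le⟩) hc fun x => ?_
    obtain ⟨τ, h0, h1, hτ⟩ := hTx x
    have : ⟪(1 - w • T) x, x⟫_ℂ = (1 - conj w * τ) * ‖x‖ ^ 2 := by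
      rw [sub_apply, inner_sub_left, one_apply_eq_self, smul_apply,
        inner_smul_left, hτ, inner_self_eq_norm_sq_to_K]
      simp
      ring
    have h2 : (1 - conj w * τ) = conj (1 - w * τ) := by simp
    rw [this, h2, norm_mul, RCLike.norm_conj, mul_comm]
    have h3 := hbd τ h0 h1
    simp only [norm_pow, Complex.norm_real, norm_norm]
    exact mul_le_mul_of_nonneg_right h3 (sq_nonneg _)
  obtain ⟨U, hU⟩ := hU
  set V : E →L[ℂ] E := ↑U⁻¹ with hV
  have hVU : ∀ x, V (x - w • T x) = x := fun x => by
    have : (V * U) x = x := by rw [hV, Units.inv_mul]; rfl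
    rwa [hU] at this
  have hUV : ∀ x, V x - w • T (V x) = x := fun x => by
    have : ((U : E →L[ℂ] E) * V) x = x := by rw [hV, Units.mul_inv]; rfl
    rwa [hU] at this
  have hVP : ∀ x, V (P x) = P x := fun x => by
    have := hVU (P x)
    rwa [hTP, smul_zero, sub_zero] at this
  have hPV : ∀ x, P (V x) = P x := fun x => by
    have := congrArg P (hUV x)
    rwa [map_sub, map_smul, hPT, smul_zero, sub_zero] at this
  -- The equation `ψ = S (φ + w ψ)` decouples into `(1 - w) P ψ = P φ` and `(1 - w T) ψ = P ψ + T
  -- φ`.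
  refine ⟨(1 - w)⁻¹ • P + V * T, fun φ ψ => ?_⟩
  rw [hG]
  have e1 : φ + z • ψ + ((1 - e : ℝ) : ℂ) • ψ = φ + w • ψ := by rw [hw, add_smul, add_assoc]
  have e2 : ((1 - w)⁻¹ • P + V * T) φ = (1 - w)⁻¹ • P φ + V (T φ) := rfl
  have e3 : S (φ + w • ψ) = T φ + P φ + w • T ψ + w • P ψ := by
    rw [map_add, map_smul, hT, hT, smul_sub]
    abel
  rw [e1, e2, e3]
  have h12 : P ψ = (1 - w)⁻¹ • P φ ↔ P ψ = P φ + w • P ψ := by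
    rw [eq_inv_smul_iff₀ hw1, sub_smul, one_smul, sub_eq_iff_eq_add]
  constructor
  · intro h
    have h2 : P ψ = (1 - w)⁻¹ • P φ := by
      rw [h, map_add, map_smul, hPP, hPV, hPT, add_zero]
    have ht : T ψ = T (V (T φ)) := by
      rw [h, map_add, map_smul, hTP, smul_zero, zero_add]
    have h3 : ψ - w • T ψ = P ψ + T φ :=
      calc ψ - w • T ψ = (1 - w)⁻¹ • P φ + (V (T φ) - w • T (V (T φ))) := by
            rw [← add_sub_assoc, ← h, ht]
        _ = P ψ + T φ := by rw [hUV, h2]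
    refine (eq_add_of_sub_eq h3).trans ?_
    nth_rewrite 1 [h12.1 h2]
    abel
  · intro h
    have h1 : P ψ = P φ + w • P ψ := by
      nth_rewrite 1 [h]
      simp only [map_add, map_smul, hPT, hPP, smul_zero, zero_add, add_zero]
    have h3 : ψ - w • T ψ = P ψ + T φ := by
      rw [h1]
      nth_rewrite 1 [h]
      abel
    rw [← h12.2 h1, ← hVP ψ, ← map_add, ← h3, hVU]

/-- Let `K = (A + 1)^{-1/2}` and let the form `g` on `D(A^{1/2})` be given by
`g(K x, K y) = ⟨x, L₀ y⟩` with a bounded symmetric `L₀`. If the unit vector `Ω` is a null vector of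
`A` and an eigenvector of `g` with eigenvalue `e`, and if `A ≥ 1` and `g - e ≥ A / 2` on its
orthogonal complement, then `g` is the form of a self-adjoint operator with simple lowest eigenvalue
`e` and spectral gap at least `1/2`. -/
theorem exists_operator_of_form {A : E →ₗ.[ℂ] E} {R K : E →L[ℂ] E} (h : IsResolventSqrt A R K)
    {Ω : E} (hΩ : ‖Ω‖ = 1) (hKΩ : K Ω = Ω) {L₀ : E →L[ℂ] E}
    (hL : ∀ x y, ⟪L₀ x, y⟫_ℂ = ⟪x, L₀ y⟫_ℂ) {e : ℝ} (hLΩ : L₀ Ω = (e : ℂ) • Ω)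
    (hgap : ∀ y, ⟪Ω, y⟫_ℂ = 0 → 2 * ‖K y‖ ^ 2 ≤ ‖y‖ ^ 2)
    (hco : ∀ y, ⟪Ω, y⟫_ℂ = 0 →
      1 / 2 * (‖y‖ ^ 2 - ‖K y‖ ^ 2) ≤ (⟪L₀ y, y⟫_ℂ).re - e * ‖K y‖ ^ 2)
    {g : E → E → ℂ} (hg : ∀ x y, g (K x) (K y) = ⟪x, L₀ y⟫_ℂ) :
    ∃ G : E →ₗ.[ℂ] E, IsOperatorOfForm (formDomain A) g G ∧ IsSelfAdjoint G ∧
      IsLeast {r : ℝ | (r : ℂ) ∈ spectrumOf G} e ∧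
      (∀ ψ, (ψ, (e : ℂ) • ψ) ∈ G.graph ↔ ψ ∈ Submodule.span ℂ {Ω}) ∧
      ∀ z ∈ spectrumOf G, z = (e : ℂ) ∨ ∃ r : ℝ, z = (r : ℂ) ∧ e + 1 / 2 ≤ r := by
  have hΩΩ : ⟪Ω, Ω⟫_ℂ = 1 := by rw [inner_self_eq_norm_sq_to_K, hΩ]; simp
  -- `L` is the bounded operator belonging to the form of `G - e + 1`.
  set L : E →L[ℂ] E := L₀ + ((1 - e : ℝ) : ℂ) • R with hLdef
  have hLx : ∀ x, L x = L₀ x + ((1 - e : ℝ) : ℂ) • K (K x) := fun x => by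
    rw [h.mul_self]; rfl
  have hLs : ∀ x y, ⟪L x, y⟫_ℂ = ⟪x, L y⟫_ℂ := fun x y => by
    rw [hLx, hLx, inner_add_left, inner_add_right, hL, inner_smul_left, inner_smul_right,
      Complex.conj_ofReal, h.symm, h.symm]
  have hLΩ' : L Ω = Ω := by
    rw [hLx, hLΩ, hKΩ, hKΩ, ← add_smul]
    push_cast
    rw [add_sub_cancel, one_smul]
  have hLre : ∀ y, (⟪L y, y⟫_ℂ).re = (⟪L₀ y, y⟫_ℂ).re + (1 - e) * ‖K y‖ ^ 2 := fun y => by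
    have h1 : (⟪K y, K y⟫_ℂ).re = ‖K y‖ ^ 2 := inner_self_eq_norm_sq (𝕜 := ℂ) _
    rw [hLx, inner_add_left, inner_smul_left, Complex.conj_ofReal, h.symm, Complex.add_re,
      Complex.re_ofReal_mul, h1]
  -- `hco` gives `⟨L y, y⟩ ≥ ‖y‖²/2 + ‖K y‖²/2`. Dropping the last term yields coercivity; using
  -- `‖y‖² ≥ 2 ‖K y‖²` yields `3/2`, the origin of the gap.
  have hLorth : ∀ y, ⟪Ω, y⟫_ℂ = 0 → 1 / 2 * ‖y‖ ^ 2 ≤ (⟪L y, y⟫_ℂ).re ∧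
      3 / 2 * ‖K y‖ ^ 2 ≤ (⟪L y, y⟫_ℂ).re := fun y hy => by
    have h1 := hco y hy
    have h2 := hgap y hy
    rw [hLre]
    constructor <;> nlinarith [sq_nonneg ‖K y‖]
  have hLco : ∀ x, 1 / 2 * ‖x‖ ^ 2 ≤ (⟪L x, x⟫_ℂ).re := by
    intro x
    set y := x - ⟪Ω, x⟫_ℂ • Ω with hy
    have hyΩ : ⟪Ω, y⟫_ℂ = 0 := by rw [hy, inner_sub_right, inner_smul_right, hΩΩ]; simp
    have hyΩ' : ⟪y, Ω⟫_ℂ = 0 := inner_eq_zero_symm.1 hyΩ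
    have hx : x = ⟪Ω, x⟫_ℂ • Ω + y := by rw [hy, add_sub_cancel]
    have h1 := (hLorth y hyΩ).1
    have h2 : ⟪L x, x⟫_ℂ = (‖⟪Ω, x⟫_ℂ‖ ^ 2 : ℝ) + ⟪L y, y⟫_ℂ := by
      have e1 : L x = ⟪Ω, x⟫_ℂ • Ω + L y := by
        nth_rewrite 1 [hx]
        rw [map_add, map_smul, hLΩ']
      have e2 : ⟪L y, Ω⟫_ℂ = 0 := by rw [hLs, hLΩ', hyΩ']
      rw [e1]
      nth_rewrite 2 [hx]
      rw [inner_add_left, inner_add_right, inner_add_right, inner_smul_right (L y), e2,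
        inner_smul_left _ y, hyΩ, inner_smul_left, inner_smul_right, hΩΩ]
      have := Complex.normSq_eq_conj_mul_self (z := ⟪Ω, x⟫_ℂ)
      rw [Complex.normSq_eq_norm_sq] at this
      rw [this]
      ring
    have h3 : ‖x‖ ^ 2 = ‖⟪Ω, x⟫_ℂ‖ ^ 2 + ‖y‖ ^ 2 := by
      have e1 : ‖x‖ ^ 2 = ‖⟪Ω, x⟫_ℂ • Ω + y‖ ^ 2 := by rw [← hx]
      rw [e1, norm_add_sq (𝕜 := ℂ), inner_smul_left, hyΩ, norm_smul, hΩ]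
      simp
    rw [h2, h3, Complex.add_re, Complex.ofReal_re]
    nlinarith [sq_nonneg ‖⟪Ω, x⟫_ℂ‖]
  have hunit : IsUnit L := by
    refine ContinuousLinearMap.isUnit_of_forall_le_norm_inner_map L (c := 1 / 2) (by norm_num)
      fun x => ?_
    have h1 := (hLco x).trans (Complex.re_le_norm _)
    rw [mul_comm]
    exact h1
  obtain ⟨U, hU⟩ := hunit
  set V : E →L[ℂ] E := ↑U⁻¹ with hV
  have hVL : ∀ x, V (L x) = x := fun x => by
    have : (V * U) x = x := by rw [hV, Units.inv_mul]; rfl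
    rwa [hU] at this
  have hLV : ∀ x, L (V x) = x := fun x => by
    have : ((U : E →L[ℂ] E) * V) x = x := by rw [hV, Units.mul_inv]; rfl
    rwa [hU] at this
  have hVs : ∀ x y, ⟪V x, y⟫_ℂ = ⟪x, V y⟫_ℂ := fun x y => by
    nth_rewrite 1 [← hLV y]
    rw [← hLs, hLV]
  have hVΩ : V Ω = Ω := by
    have := hVL Ω
    rwa [hLΩ'] at this
  -- Formally `G - e + 1 = K⁻¹ L K⁻¹`, so this is its inverse.
  set S : E →L[ℂ] E := K * V * K with hSdef
  have hSx : ∀ x, S x = K (V (K x)) := fun x => rfl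
  have hSs : ∀ x y, ⟪S x, y⟫_ℂ = ⟪x, S y⟫_ℂ := fun x y => by
    rw [hSx, hSx, h.symm, hVs, h.symm]
  have hSi : Function.Injective S := fun x y hxy => by
    rw [hSx, hSx] at hxy
    have h1 := congrArg L (h.injective hxy)
    rw [hLV, hLV] at h1
    exact h.injective h1
  have hSΩ : S Ω = Ω := by rw [hSx, hKΩ, hVΩ, hKΩ]
  -- Apply `hLorth` to `y = L⁻¹ K x`: then `K y = S x` and `⟨L y, y⟩ = ⟨K x, y⟩ = ⟨x, S x⟩`.
  have hSgap : ∀ x, ⟪Ω, x⟫_ℂ = 0 → 3 / 2 * ‖S x‖ ^ 2 ≤ (⟪S x, x⟫_ℂ).re := fun x hx => by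
    have h1 : ⟪Ω, V (K x)⟫_ℂ = 0 := by rw [← hVs, hVΩ, ← h.symm, hKΩ, hx]
    have h2 := (hLorth _ h1).2
    rwa [hLV, h.symm, ← inner_conj_symm, Complex.conj_re] at h2
  obtain ⟨G, hGsa, hG⟩ := exists_isSelfAdjoint_of_symm hSs hSi (1 - e)
  have hΩ0 : Ω ≠ 0 := by
    rintro rfl
    simp at hΩ
  have heig : ∀ ψ, (ψ, (e : ℂ) • ψ) ∈ G.graph ↔ S ψ = ψ := fun ψ => by
    rw [hG, ← add_smul]
    push_cast
    rw [add_sub_cancel, one_smul, eq_comm]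
  have hspec : ∀ z ∈ spectrumOf G, z = (e : ℂ) ∨ ∃ r : ℝ, z = (r : ℂ) ∧ e + 1 / 2 ≤ r := by
    intro z hz
    by_contra! hcon
    exact hz (exists_isResolvent_of_gap hSs hG hΩ hSΩ hSgap hcon.1 hcon.2)
  refine ⟨G, fun ψ η => ?_, hGsa, ⟨?_, ?_⟩, fun ψ => ?_, hspec⟩
  · rw [hG, h.mem_formDomain_iff]
    have key : ∀ y, (∀ φ ∈ formDomain A, g φ (K y) = ⟪φ, η⟫_ℂ) ↔
        K y = S (η + ((1 - e : ℝ) : ℂ) • K y) := by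
      intro y
      -- Testing with `φ = K x` for all `x` turns the weak equation into an identity of vectors;
      -- adding `(1 - e) K (K y)` to both sides then replaces `L₀` by the invertible `L`.
      have h1 : (∀ φ ∈ formDomain A, g φ (K y) = ⟪φ, η⟫_ℂ) ↔ L₀ y = K η := by
        constructor
        · intro h2
          refine ext_inner_left ℂ fun x => ?_
          rw [← hg, h2 _ (h.apply_mem_formDomain x), h.symm]
        · intro h2 φ hφ
          obtain ⟨x, rfl⟩ := h.mem_formDomain_iff.1 hφ
          rw [hg, h2, h.symm]
      rw [h1, hSx, map_add, map_smul]
      constructor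
      · intro h2
        rw [← h2, ← hLx, hVL]
      · intro h2
        have h3 := congrArg L (h.injective h2)
        rw [hLV, hLx] at h3
        exact add_right_cancel h3
    constructor
    · intro h1
      have h2 : K (V (K (η + ((1 - e : ℝ) : ℂ) • ψ))) = ψ := h1.symm
      refine ⟨⟨_, h2⟩, ?_⟩
      rw [← h2] at h1 ⊢
      exact (key _).2 h1
    · rintro ⟨⟨y, rfl⟩, h1⟩
      exact (key y).1 h1
  -- A resolvent at the eigenvalue `e` would map `0` to `Ω`.
  · rintro ⟨R', hR'⟩
    have h1 : (Ω, (0 : E) + (e : ℂ) • Ω) ∈ G.graph := by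
      rw [zero_add, heig, hSΩ]
    have h2 := (hR' 0 Ω).2 h1
    rw [map_zero] at h2
    exact hΩ0 h2
  · intro r hr
    rcases hspec _ hr with h1 | ⟨s, h1, h2⟩
    · exact (Complex.ofReal_injective h1).ge
    · rw [Complex.ofReal_injective h1]
      linarith
  · rw [heig, Submodule.mem_span_singleton]
    constructor
    · intro h1
      refine ⟨⟪Ω, ψ⟫_ℂ, ?_⟩
      set y := ψ - ⟪Ω, ψ⟫_ℂ • Ω with hy
      have hyΩ : ⟪Ω, y⟫_ℂ = 0 := by rw [hy, inner_sub_right, inner_smul_right, hΩΩ]; simp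
      have h2 : S y = y := by rw [hy, map_sub, map_smul, hSΩ, h1]
      have h3 := hSgap y hyΩ
      have h4 : (⟪y, y⟫_ℂ).re = ‖y‖ ^ 2 := inner_self_eq_norm_sq (𝕜 := ℂ) _
      rw [h2, h4] at h3
      have h5 : ‖y‖ = 0 := by nlinarith [norm_nonneg y]
      exact (sub_eq_zero.1 (norm_eq_zero.1 h5)).symm
    · rintro ⟨a, rfl⟩
      rw [map_smul, hSΩ]

end OperatorOfForm

/-! ### Hilbert sums described by slices, and operators `1 ⊗ B` -/

section Slicing

universe u v w
variable {γ : Type u} {K : Type v} {E : Type w} [NormedAddCommGroup K] [InnerProductSpace ℂ K]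
  [NormedAddCommGroup E] [InnerProductSpace ℂ E]

/-- The slices `s g : K → E` identify `K` with the Hilbert sum of copies of `E` indexed by `γ`. -/
structure IsSlicing (s : γ → K →ₗ[ℂ] E) : Prop where
  hasSum_norm_sq : ∀ ψ, HasSum (fun g => ‖s g ψ‖ ^ 2) (‖ψ‖ ^ 2)
  exists_eq : ∀ w : γ → E, Summable (fun g => ‖w g‖ ^ 2) → ∃ ψ, ∀ g, s g ψ = w g

namespace IsSlicing

variable {s : γ → K →ₗ[ℂ] E}

theorem ext (h : IsSlicing s) {φ ψ : K} (he : ∀ g, s g φ = s g ψ) : φ = ψ := by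
  have h1 := h.hasSum_norm_sq (φ - ψ)
  simp only [map_sub, he, sub_self, norm_zero, ne_eq, OfNat.ofNat_ne_zero, not_false_eq_true,
    zero_pow] at h1
  have h2 := h1.unique hasSum_zero
  exact sub_eq_zero.1 (norm_eq_zero.1 (pow_eq_zero_iff two_ne_zero |>.1 h2))

/-- Polarization of the norm identity. -/
theorem hasSum_inner (h : IsSlicing s) (φ ψ : K) :
    HasSum (fun g => ⟪s g φ, s g ψ⟫_ℂ) ⟪φ, ψ⟫_ℂ := by
  have hc : ∀ χ : K, HasSum (fun g => ((‖s g χ‖ : ℂ) ^ 2)) ((‖χ‖ : ℂ) ^ 2) := fun χ => by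
    have := Complex.hasSum_ofReal.2 (h.hasSum_norm_sq χ)
    simpa using this
  have h1 := ((((hc (φ + ψ)).sub (hc (φ - ψ))).add
    (((hc (φ - Complex.I • ψ)).sub (hc (φ + Complex.I • ψ))).mul_right Complex.I)).div_const 4)
  rw [inner_eq_sum_norm_sq_div_four]
  refine HasSum.congr_fun h1 fun g => ?_
  rw [inner_eq_sum_norm_sq_div_four]
  simp

theorem exists_amp (h : IsSlicing s) (B : E →L[ℂ] E) :
    ∃ T : K →L[ℂ] K, ∀ g ψ, s g (T ψ) = B (s g ψ) := by
  have hle : ∀ (ψ : K) (g : γ), ‖B (s g ψ)‖ ^ 2 ≤ ‖B‖ ^ 2 * ‖s g ψ‖ ^ 2 := fun ψ g => by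
    rw [← mul_pow]
    exact pow_le_pow_left₀ (norm_nonneg _) (B.le_opNorm _) 2
  have hsum : ∀ ψ, Summable fun g => ‖B (s g ψ)‖ ^ 2 := fun ψ =>
    Summable.of_nonneg_of_le (fun _ => sq_nonneg _) (hle ψ)
      ((h.hasSum_norm_sq ψ).summable.mul_left _)
  choose T hT using fun ψ => h.exists_eq (fun g => B (s g ψ)) (hsum ψ)
  let T' : K →ₗ[ℂ] K :=
    { toFun := T
      map_add' := fun φ ψ => h.ext fun g => by simp [hT]
      map_smul' := fun c ψ => h.ext fun g => by simp [hT] }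
  refine ⟨T'.mkContinuous ‖B‖ fun ψ => ?_, fun g ψ => hT ψ g⟩
  rw [← sq_le_sq₀ (norm_nonneg _) (by positivity), mul_pow]
  refine hasSum_le (fun g => ?_) (h.hasSum_norm_sq (T ψ)) ((h.hasSum_norm_sq ψ).mul_left (‖B‖ ^ 2))
  rw [hT]
  exact hle ψ g

/-- The operator `1 ⊗ B`, acting as `B` on every slice. -/
def amp (h : IsSlicing s) (B : E →L[ℂ] E) : K →L[ℂ] K := (h.exists_amp B).choose

theorem slice_amp (h : IsSlicing s) (B : E →L[ℂ] E) (g : γ) (ψ : K) :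
    s g (h.amp B ψ) = B (s g ψ) := (h.exists_amp B).choose_spec g ψ

theorem amp_symm (h : IsSlicing s) {B : E →L[ℂ] E} (hB : ∀ x y, ⟪B x, y⟫_ℂ = ⟪x, B y⟫_ℂ)
    (φ ψ : K) : ⟪h.amp B φ, ψ⟫_ℂ = ⟪φ, h.amp B ψ⟫_ℂ := by
  refine (h.hasSum_inner _ _).unique ?_
  simp only [slice_amp, hB]
  simpa only [slice_amp] using h.hasSum_inner φ (h.amp B ψ)

theorem isNonnegResolvent_amp (h : IsSlicing s) {R : E →L[ℂ] E} (hR : IsNonnegResolvent R) :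
    IsNonnegResolvent (h.amp R) where
  symm := h.amp_symm hR.symm
  sq_le ψ := by
    refine hasSum_le (fun g => ?_) (h.hasSum_norm_sq _)
      (Complex.hasSum_re (h.hasSum_inner (h.amp R ψ) ψ))
    rw [slice_amp]
    exact hR.sq_le _

theorem isResolvent_of_mem_graph_iff (h : IsSlicing s) {A : E →ₗ.[ℂ] E} {R : E →L[ℂ] E}
    (hR : IsResolvent A (-1) R) {A' : K →ₗ.[ℂ] K}
    (hA : ∀ ψ η, (ψ, η) ∈ A'.graph ↔ ∀ g, (s g ψ, s g η) ∈ A.graph) :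
    IsResolvent A' (-1) (h.amp R) := by
  refine IsResolvent.of_mem_graph_iff fun ψ η => ?_
  rw [hA]
  simp only [hR.mem_graph_iff]
  constructor
  · intro h1
    refine h.ext fun g => ?_
    rw [h.slice_amp, map_add, ← h1]
  · intro h1 g
    nth_rewrite 1 [h1]
    rw [h.slice_amp, map_add]

theorem comp {E' : Type*} [NormedAddCommGroup E'] [InnerProductSpace ℂ E'] (h : IsSlicing s)
    (U : E ≃ₗᵢ[ℂ] E') : IsSlicing fun g => (U.toLinearEquiv : E →ₗ[ℂ] E') ∘ₗ s g where
  hasSum_norm_sq ψ := by simpa using h.hasSum_norm_sq ψ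
  exists_eq w hw := by
    obtain ⟨ψ, hψ⟩ := h.exists_eq (fun g => U.symm (w g)) (by simpa using hw)
    exact ⟨ψ, fun g => by simp [hψ]⟩

end IsSlicing

end Slicing

/-! ### Slicing square-summable families -/

section Lp

theorem hasSum_norm_sq {α : Type*} (ψ : lp (fun _ : α => ℂ) 2) :
    HasSum (fun a => ‖ψ a‖ ^ 2) (‖ψ‖ ^ 2) := by
  simpa using lp.hasSum_norm (p := 2) (by norm_num) ψ

theorem memℓp_two_iff {α : Type*} {f : α → ℂ} :
    Memℓp f 2 ↔ Summable fun a => ‖f a‖ ^ 2 := by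
  simpa using memℓp_gen_iff (E := fun _ : α => ℂ) (p := 2) (f := f) (by norm_num)

theorem isSlicing_pullback {α β γ : Type*} (e : γ → α → β) (he : ∀ g, Function.Injective (e g))
    (hb : Function.Bijective fun p : γ × α => e p.1 p.2) :
    IsSlicing fun g => pullback (e g) (he g) where
  hasSum_norm_sq ψ := by
    have h := (Equiv.ofBijective _ hb).hasSum_iff.2 (hasSum_norm_sq ψ)
    exact h.prod_fiberwise fun g => hasSum_norm_sq (pullback (e g) (he g) ψ)
  exists_eq w hw := by
    let u := Equiv.ofBijective _ hb
    have hu : ∀ g a, u.symm (e g a) = (g, a) := fun g a => u.symm_apply_apply (g, a)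
    have hmem : Memℓp (fun x => w (u.symm x).1 (u.symm x).2) 2 := by
      rw [memℓp_two_iff, ← u.summable_iff]
      have : (fun x => ‖w (u.symm x).1 (u.symm x).2‖ ^ 2) ∘ u =
          fun p : γ × α => ‖w p.1 p.2‖ ^ 2 := by
        funext p
        simp
      rw [this, summable_prod_of_nonneg fun p => by positivity]
      refine ⟨fun g => (hasSum_norm_sq (w g)).summable, ?_⟩
      simpa only [(hasSum_norm_sq (w _)).tsum_eq] using hw
    refine ⟨⟨_, hmem⟩, fun g => ?_⟩
    ext a
    change w (u.symm (e g a)).1 (u.symm (e g a)).2 = w g a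
    rw [hu]

end Lp

/-! ### Slices of the tensor product and product vectors -/

section Sites

universe u v
variable {𝓗 : Type u} [NormedAddCommGroup 𝓗] [InnerProductSpace ℂ 𝓗]
variable {ι : Type v} (b : HilbertBasis ι ℂ 𝓗) {A S : Finset ℕ}

theorem merge_mem (f : A → ι) (g : ↥(S \ A) → ι) {j : S} (h : (j : ℕ) ∈ A) :
    merge f g j = f ⟨j, h⟩ := dif_pos h

theorem merge_notMem (f : A → ι) (g : ↥(S \ A) → ι) {j : S} (h : (j : ℕ) ∉ A) :
    merge f g j = g ⟨j, Finset.mem_sdiff.2 ⟨j.2, h⟩⟩ := dif_neg h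

theorem isSlicing_slice (h : A ⊆ S) :
    IsSlicing (slice h : (↥(S \ A) → ι) → TensorSpace ι S →ₗ[ℂ] TensorSpace ι A) := by
  refine isSlicing_pullback (fun g f => merge f g) (merge_injective h) ⟨?_, fun F => ?_⟩
  · rintro ⟨g, f⟩ ⟨g', f'⟩ hgf
    dsimp only at hgf
    refine Prod.ext (funext fun j => ?_) (funext fun j => ?_)
    · have h1 := Finset.mem_sdiff.1 j.2
      have := congrFun hgf ⟨j, h1.1⟩
      simpa [merge, h1.2] using this
    · have := congrFun hgf ⟨j, h j.2⟩
      simpa [merge] using this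
  · refine ⟨(fun j => F ⟨j, (Finset.mem_sdiff.1 j.2).1⟩, fun j => F ⟨j, h j.2⟩),
      funext fun j => ?_⟩
    by_cases hj : (j : ℕ) ∈ A
    · simp [merge_mem _ _ hj]
    · simp [merge_notMem _ _ hj]

/-- The slice at `i` overwrites the value `g i`, so each configuration of the other sites must be
counted once; the condition `g i = n₀` picks one representative. -/
theorem isSlicing_siteSlice (i : S) (n₀ : ι) :
    IsSlicing fun g : {g : S → ι // g i = n₀} => siteSlice b i g.1 := by
  refine (isSlicing_pullback (fun (g : {g : S → ι // g i = n₀}) n => Function.update g.1 i n)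
    (fun g => Function.update_injective g.1 i) ⟨?_, fun F => ?_⟩).comp b.repr.symm
  · rintro ⟨⟨g, hg⟩, n⟩ ⟨⟨g', hg'⟩, n'⟩ h
    dsimp only at h
    refine Prod.ext (Subtype.ext (funext fun j => ?_)) ?_
    · by_cases hj : j = i
      · subst hj
        exact hg.trans hg'.symm
      · have := congrFun h j
        rwa [Function.update_of_ne hj, Function.update_of_ne hj] at this
    · simpa using congrFun h i
  · exact ⟨(⟨Function.update F i n₀, by simp⟩, F i), by simp⟩

theorem siteSlice_update (i : S) (g : S → ι) (n : ι) :
    siteSlice b i (Function.update g i n) = siteSlice b i g := by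
  unfold siteSlice
  congr 2
  funext m
  simp

theorem siteSlice_apply_eq {i : S} {g : S → ι} {ψ : TensorSpace ι S} {x : 𝓗}
    (h : ∀ n, ψ (Function.update g i n) = b.repr x n) : siteSlice b i g ψ = x := by
  change b.repr.symm (pullback _ _ ψ) = x
  rw [LinearIsometryEquiv.symm_apply_eq]
  ext n
  exact h n

theorem siteSlice_productVector (i : S) (g : S → ι) (x : S → 𝓗) :
    siteSlice b i g (productVector b S x) =
      (∏ j ∈ Finset.univ.erase i, b.repr (x j) (g j)) • x i := by
  refine siteSlice_apply_eq b fun n => ?_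
  change ∏ j, b.repr (x j) (Function.update g i n j) = _
  rw [← Finset.mul_prod_erase _ _ (Finset.mem_univ i), Function.update_self, map_smul, mul_comm]
  change _ = _ * b.repr (x i) n
  congr 1
  refine Finset.prod_congr rfl fun j hj => ?_
  rw [Function.update_of_ne (Finset.ne_of_mem_erase hj)]

/-- Restriction to `A` and then to the site `i ∈ A` is restriction to the site `i`. -/
theorem siteSlice_slice (h : A ⊆ S) (i : A) (g : ↥(S \ A) → ι) (f : A → ι)
    (ψ : TensorSpace ι S) :
    siteSlice b i f (slice h g ψ) = siteSlice b ⟨i, h i.2⟩ (merge f g) ψ := by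
  refine siteSlice_apply_eq b fun n => ?_
  have h1 : merge (S := S) (Function.update f i n) g =
      Function.update (merge f g) ⟨i, h i.2⟩ n := by
    funext j
    by_cases hj : (j : ℕ) ∈ A
    · rw [merge_mem _ _ hj]
      by_cases hji : j = ⟨i, h i.2⟩
      · subst hji
        simp
      · rw [Function.update_of_ne hji, merge_mem _ _ hj, Function.update_of_ne]
        rintro rfl
        exact hji rfl
    · rw [merge_notMem _ _ hj, Function.update_of_ne, merge_notMem _ _ hj]
      rintro rfl
      exact hj i.2
  have h2 : b.repr (siteSlice b ⟨i, h i.2⟩ (merge f g) ψ) = pullback _ _ ψ :=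
    b.repr.apply_symm_apply _
  rw [h2]
  change ψ (merge _ g) = ψ _
  rw [h1]

theorem productVector_basis [DecidableEq (S → ι)] (f : S → ι) :
    productVector b S (fun j => b (f j)) = lp.single 2 f 1 := by
  ext f'
  change ∏ j, b.repr (b (f j)) (f' j) = _
  by_cases h : f' = f
  · subst h
    classical
    simp [b.repr_self]
  · obtain ⟨j, hj⟩ := Function.ne_iff.1 h
    rw [lp.single_apply_ne _ _ _ h]
    classical
    refine Finset.prod_eq_zero (Finset.mem_univ j) ?_
    rw [b.repr_self, lp.single_apply_ne _ _ _ hj]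

/-- The basis of the tensor product consists of product vectors and spans a dense subspace.
Commutation relations can therefore be checked on product vectors. -/
theorem ext_productVector {F : Type*} [NormedAddCommGroup F] [NormedSpace ℂ F]
    {T T' : TensorSpace ι S →L[ℂ] F}
    (h : ∀ x : S → 𝓗, T (productVector b S x) = T' (productVector b S x)) : T = T' := by
  classical
  ext ψ
  have h1 : HasSum (fun f => lp.single 2 f (ψ f)) ψ := lp.hasSum_single (by norm_num) ψ
  refine (h1.mapL T).unique ?_
  have h2 : ∀ f, T (lp.single 2 f (ψ f)) = T' (lp.single 2 f (ψ f)) := fun f => by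
    have : lp.single 2 f (ψ f) = ψ f • productVector b S (fun j => b (f j)) := by
      rw [productVector_basis, ← lp.single_smul]
      simp
    rw [this, map_smul, map_smul, h]
  simp only [h2]
  exact h1.mapL T'

end Sites

/-! ### Operators acting at a single site -/

section SiteOperators

universe u v
variable {𝓗 : Type u} [NormedAddCommGroup 𝓗] [InnerProductSpace ℂ 𝓗]
variable {ι : Type v} (b : HilbertBasis ι ℂ 𝓗) {A S : Finset ℕ}

theorem siteSlice_eq_of_subtype {i : S} (n₀ : ι) {p : 𝓗 → 𝓗 → Prop} {φ ψ : TensorSpace ι S}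
    (h : ∀ g : {g : S → ι // g i = n₀}, p (siteSlice b i g.1 φ) (siteSlice b i g.1 ψ))
    (g : S → ι) : p (siteSlice b i g φ) (siteSlice b i g ψ) := by
  have := h ⟨Function.update g i n₀, by simp⟩
  rwa [siteSlice_update] at this

theorem mem_graph_siteOperator [Nonempty ι] (H : 𝓗 →ₗ.[ℂ] 𝓗) (i : S) {ψ η : TensorSpace ι S} :
    (ψ, η) ∈ (siteOperator b H S i).graph ↔
      ∀ g, (siteSlice b i g ψ, siteSlice b i g η) ∈ H.graph := by
  rw [siteOperator, Submodule.toLinearPMap_graph_eq]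
  · simp
  · rintro ⟨ψ, η⟩ h hψ
    dsimp only at hψ ⊢
    subst hψ
    refine (isSlicing_siteSlice b i (Classical.arbitrary ι)).ext fun g => ?_
    have h1 : (siteSlice b i g.1 (0 : TensorSpace ι S), siteSlice b i g.1 η) ∈ H.graph := by
      simpa using (Submodule.mem_iInf _).1 h g.1
    rw [map_zero] at h1 ⊢
    exact LinearPMap.graph_fst_eq_zero_snd H h1 rfl

/-- The bounded operator `1 ⊗ ⋯ ⊗ B ⊗ ⋯ ⊗ 1` with `B` in the slot `i`. -/
def siteAmp [Nonempty ι] (i : S) (B : 𝓗 →L[ℂ] 𝓗) : TensorSpace ι S →L[ℂ] TensorSpace ι S :=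
  (isSlicing_siteSlice b i (Classical.arbitrary ι)).amp B

theorem siteSlice_siteAmp [Nonempty ι] (i : S) (B : 𝓗 →L[ℂ] 𝓗) (g : S → ι)
    (ψ : TensorSpace ι S) : siteSlice b i g (siteAmp b i B ψ) = B (siteSlice b i g ψ) :=
  siteSlice_eq_of_subtype b (p := fun x y => x = B y) (Classical.arbitrary ι)
    (fun g => (isSlicing_siteSlice b i (Classical.arbitrary ι)).slice_amp B g ψ) g

theorem siteAmp_productVector [Nonempty ι] (i : S) (B : 𝓗 →L[ℂ] 𝓗) (x : S → 𝓗) :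
    siteAmp b i B (productVector b S x) =
      productVector b S (Function.update x i (B (x i))) := by
  refine (isSlicing_siteSlice b i (Classical.arbitrary ι)).ext fun g => ?_
  rw [siteSlice_siteAmp, siteSlice_productVector, siteSlice_productVector, map_smul,
    Function.update_self]
  congr 1
  refine Finset.prod_congr rfl fun j hj => ?_
  rw [Function.update_of_ne (Finset.ne_of_mem_erase hj)]

theorem siteAmp_commute [Nonempty ι] {i j : S} (hij : i ≠ j) (B B' : 𝓗 →L[ℂ] 𝓗) :
    Commute (siteAmp b i B) (siteAmp b j B') := by
  refine ext_productVector b fun x => ?_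
  simp only [mul_apply_eq_comp, siteAmp_productVector]
  rw [Function.update_of_ne hij, Function.update_of_ne hij.symm, Function.update_comm hij]

theorem isResolvent_siteAmp [Nonempty ι] {H : 𝓗 →ₗ.[ℂ] 𝓗} {R : 𝓗 →L[ℂ] 𝓗}
    (hR : IsResolvent H (-1) R) (i : S) :
    IsResolvent (siteOperator b H S i) (-1) (siteAmp b i R) := by
  refine (isSlicing_siteSlice b i (Classical.arbitrary ι)).isResolvent_of_mem_graph_iff hR
    fun ψ η => ?_
  rw [mem_graph_siteOperator]
  exact ⟨fun h g => h g.1, siteSlice_eq_of_subtype b (p := fun x y => (x, y) ∈ H.graph)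
    (Classical.arbitrary ι)⟩

theorem mem_graph_freeHamiltonian (H : 𝓗 →ₗ.[ℂ] 𝓗) {ψ η : TensorSpace ι S} :
    (ψ, η) ∈ (freeHamiltonian b H S).graph ↔ ∃ a : S → TensorSpace ι S,
      (∀ i, (ψ, a i) ∈ (siteOperator b H S i).graph) ∧ η = ∑ i, a i := by
  rw [freeHamiltonian, mem_graph_sum_iff]
  simp

theorem slice_mem_graph_siteOperator [Nonempty ι] (H : 𝓗 →ₗ.[ℂ] 𝓗) (h : A ⊆ S) (i : A)
    {ψ η : TensorSpace ι S} (hψ : (ψ, η) ∈ (siteOperator b H S ⟨i, h i.2⟩).graph)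
    (g : ↥(S \ A) → ι) : (slice h g ψ, slice h g η) ∈ (siteOperator b H A i).graph := by
  rw [mem_graph_siteOperator] at hψ ⊢
  intro f
  rw [siteSlice_slice, siteSlice_slice]
  exact hψ _

end SiteOperators

/-! ### The vacuum vector and its projections -/

section Vacuum

universe u v
variable {𝓗 : Type u} [NormedAddCommGroup 𝓗] [InnerProductSpace ℂ 𝓗]
variable {ι : Type v} (b : HilbertBasis ι ℂ 𝓗) {A S : Finset ℕ} {Ω : 𝓗}

theorem siteSlice_vacuum_mem (i : S) (g : S → ι) :
    ∃ c : ℂ, siteSlice b i g (vacuum b Ω S) = c • Ω :=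
  ⟨_, siteSlice_productVector b i g fun _ => Ω⟩

theorem slice_vacuum_mem (h : A ⊆ S) (g : ↥(S \ A) → ι) :
    ∃ c : ℂ, slice h g (vacuum b Ω S) = c • vacuum b Ω A := by
  refine ⟨∏ j : ↥(S \ A), b.repr Ω (g j), ?_⟩
  ext f
  let ω : ι → ℂ := fun n => b.repr Ω n
  change ∏ j : S, ω (merge f g j) = (∏ j : ↥(S \ A), ω (g j)) * ∏ j : A, ω (f j)
  -- All three products are rewritten over finsets of `ℕ` with one common factor, so that the
  -- product over `S` splits into those over `S \ A` and `A`. The value `1` off `S` is never used.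
  let u : ℕ → ℂ := fun j => if hj : j ∈ S then ω (merge f g ⟨j, hj⟩) else 1
  have hu : ∀ j (hj : j ∈ S), u j = ω (merge f g ⟨j, hj⟩) := fun j hj => dif_pos hj
  have h1 : ∏ j : S, ω (merge f g j) = ∏ j ∈ S, u j := by
    rw [← Finset.prod_coe_sort S]
    exact Finset.prod_congr rfl fun j _ => (hu j j.2).symm
  have h2 : ∏ j : ↥(S \ A), ω (g j) = ∏ j ∈ S \ A, u j := by
    rw [← Finset.prod_coe_sort (S \ A)]
    refine Finset.prod_congr rfl fun j _ => ?_
    have hj := Finset.mem_sdiff.1 j.2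
    rw [hu j hj.1, merge_notMem (j := ⟨j, hj.1⟩) f g hj.2]
  have h3 : ∏ j : A, ω (f j) = ∏ j ∈ A, u j := by
    rw [← Finset.prod_coe_sort A]
    refine Finset.prod_congr rfl fun j _ => ?_
    rw [hu j (h j.2), merge_mem (j := ⟨j, h j.2⟩) f g j.2]
  rw [h1, h2, h3, Finset.prod_sdiff h]

/-- The projection onto the line spanned by a unit vector. -/
def lineProj (Ω : 𝓗) : 𝓗 →L[ℂ] 𝓗 := (innerSL ℂ Ω).smulRight Ω

theorem lineProj_apply (x : 𝓗) : lineProj Ω x = ⟪Ω, x⟫_ℂ • Ω := rfl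

theorem lineProj_idem (hΩ : ‖Ω‖ = 1) (x : 𝓗) : lineProj Ω (lineProj Ω x) = lineProj Ω x := by
  simp [lineProj_apply, hΩ]

theorem lineProj_symm (x y : 𝓗) : ⟪lineProj Ω x, y⟫_ℂ = ⟪x, lineProj Ω y⟫_ℂ := by
  simp [lineProj_apply]

theorem norm_sq_sub_lineProj (hΩ : ‖Ω‖ = 1) (x : 𝓗) :
    ‖x - lineProj Ω x‖ ^ 2 = ‖x‖ ^ 2 - ‖lineProj Ω x‖ ^ 2 := by
  have h : ⟪x - lineProj Ω x, lineProj Ω x⟫_ℂ = 0 := by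
    rw [← lineProj_symm, map_sub, lineProj_idem hΩ, sub_self, inner_zero_left]
  have h1 : ‖x‖ ^ 2 = ‖(x - lineProj Ω x) + lineProj Ω x‖ ^ 2 := by rw [sub_add_cancel]
  rw [h1, norm_add_sq (𝕜 := ℂ), h]
  simp

/-- `∏_{i ∈ T} P_{Ω_i}` exists as a contraction, and `1 - ∏ P_{Ω_i} ≤ ∑ (1 - P_{Ω_i})`. -/
theorem exists_prod_siteAmp_lineProj [Nonempty ι] (hΩ : ‖Ω‖ = 1) (T : Finset S) :
    ∃ Q : TensorSpace ι S →L[ℂ] TensorSpace ι S,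
      (∀ x, Q (productVector b S x) =
        productVector b S fun j => if j ∈ T then lineProj Ω (x j) else x j) ∧
      (∀ ψ, ‖Q ψ‖ ≤ ‖ψ‖) ∧
      ∀ ψ, ‖ψ‖ ^ 2 - ‖Q ψ‖ ^ 2 ≤
        ∑ i ∈ T, (‖ψ‖ ^ 2 - ‖siteAmp b i (lineProj Ω) ψ‖ ^ 2) := by
  classical
  have hpy : ∀ (i : S) (ψ : TensorSpace ι S), ‖ψ - siteAmp b i (lineProj Ω) ψ‖ ^ 2 =
      ‖ψ‖ ^ 2 - ‖siteAmp b i (lineProj Ω) ψ‖ ^ 2 := fun i ψ => by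
    have hs := isSlicing_siteSlice b i (Classical.arbitrary ι)
    refine (hs.hasSum_norm_sq _).unique ?_
    have := (hs.hasSum_norm_sq ψ).sub (hs.hasSum_norm_sq (siteAmp b i (lineProj Ω) ψ))
    simpa only [map_sub, siteSlice_siteAmp, norm_sq_sub_lineProj hΩ] using this
  induction T using Finset.induction_on with
  | empty => exact ⟨1, by simp, by simp, by simp⟩
  | insert i T hi ih =>
    obtain ⟨Q, hQ, hQ1, hQ2⟩ := ih
    have hcomm : ∀ ψ, siteAmp b i (lineProj Ω) (Q ψ) = Q (siteAmp b i (lineProj Ω) ψ) := by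
      intro ψ
      have : siteAmp b i (lineProj Ω) * Q = Q * siteAmp b i (lineProj Ω) := by
        refine ext_productVector b fun x => ?_
        simp only [mul_apply_eq_comp, siteAmp_productVector, hQ]
        congr 1
        funext j
        by_cases hj : j = i
        · subst hj
          simp [hi]
        · simp [Function.update_of_ne hj]
      exact congrArg (fun T : TensorSpace ι S →L[ℂ] TensorSpace ι S => T ψ) this
    refine ⟨siteAmp b i (lineProj Ω) * Q, fun x => ?_, fun ψ => ?_, fun ψ => ?_⟩
    · simp only [mul_apply_eq_comp, siteAmp_productVector, hQ]
      congr 1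
      funext j
      by_cases hj : j = i
      · subst hj
        simp [hi]
      · simp [hj]
    · have h1 := hpy i (Q ψ)
      have h2 := hQ1 ψ
      rw [mul_apply_eq_comp]
      refine le_trans ?_ h2
      rw [← sq_le_sq₀ (norm_nonneg _) (norm_nonneg _)]
      linarith [sq_nonneg ‖Q ψ - siteAmp b i (lineProj Ω) (Q ψ)‖]
    · rw [Finset.sum_insert hi, mul_apply_eq_comp]
      have h1 := hpy i (Q ψ)
      -- The new factor `P` loses `‖(1 - P) Q ψ‖² = ‖Q (1 - P) ψ‖² ≤ ‖(1 - P) ψ‖²`, because `P`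
      -- commutes with the contraction `Q`.
      have h2 : ‖Q ψ - siteAmp b i (lineProj Ω) (Q ψ)‖ ^ 2 ≤
          ‖ψ - siteAmp b i (lineProj Ω) ψ‖ ^ 2 := by
        rw [hcomm, ← map_sub]
        exact pow_le_pow_left₀ (norm_nonneg _) (hQ1 _) 2
      rw [hpy i ψ] at h2
      linarith [hQ2 ψ]

theorem productVector_smul (c : S → ℂ) (x : S → 𝓗) :
    productVector b S (fun j => c j • x j) = (∏ j, c j) • productVector b S x := by
  ext f
  change ∏ j, b.repr (c j • x j) (f j) = (∏ j, c j) * ∏ j, b.repr (x j) (f j)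
  rw [← Finset.prod_mul_distrib]
  refine Finset.prod_congr rfl fun j _ => ?_
  rw [map_smul]
  rfl

theorem vacuum_ne_zero (hΩ : ‖Ω‖ = 1) : vacuum b Ω S ≠ 0 := by
  have h1 : ∃ n, b.repr Ω n ≠ 0 := by
    by_contra! h
    have : b.repr Ω = 0 := by
      ext n
      exact h n
    rw [LinearIsometryEquiv.map_eq_zero_iff] at this
    simp [this] at hΩ
  obtain ⟨n, hn⟩ := h1
  intro h
  have h2 : vacuum b Ω S (fun _ => n) = 0 := by rw [h]; rfl
  have h3 : ∏ _j : S, b.repr Ω n = 0 := h2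
  rw [Finset.prod_const] at h3
  exact pow_ne_zero _ hn h3

/-- The product of the projections `P_{Ω_i}` over all sites is the projection onto the vacuum. -/
theorem exists_vacuum_bound [Nonempty ι] (hΩ : ‖Ω‖ = 1) :
    ‖vacuum b Ω S‖ = 1 ∧ ∀ ψ : TensorSpace ι S, ‖ψ‖ ^ 2 - ‖⟪vacuum b Ω S, ψ⟫_ℂ‖ ^ 2 ≤
      ∑ i, (‖ψ‖ ^ 2 - ‖siteAmp b i (lineProj Ω) ψ‖ ^ 2) := by
  classical
  obtain ⟨Q, hQ, -, hQ2⟩ := exists_prod_siteAmp_lineProj (S := S) b hΩ Finset.univ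
  have hQx : ∀ ψ, Q ψ = ⟪vacuum b Ω S, ψ⟫_ℂ • vacuum b Ω S := by
    intro ψ
    have : Q = lineProj (vacuum b Ω S) := by
      refine ContinuousLinearMap.ext fun ψ => ?_
      have h1 : HasSum (fun f => lp.single 2 f (ψ f)) ψ := lp.hasSum_single (by norm_num) ψ
      refine (h1.mapL Q).unique ?_
      have h2 : ∀ f, Q (lp.single 2 f (ψ f)) = lineProj (vacuum b Ω S) (lp.single 2 f (ψ f)) := by
        intro f
        have h3 : lp.single 2 f (ψ f) = ψ f • productVector b S (fun j => b (f j)) := by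
          rw [productVector_basis, ← lp.single_smul]
          simp
        have h4 : ⟪vacuum b Ω S, productVector b S (fun j => b (f j))⟫_ℂ =
            ∏ j, ⟪Ω, b (f j)⟫_ℂ := by
          rw [productVector_basis, lp.inner_single_right]
          change 1 * conj (∏ j, b.repr Ω (f j)) = _
          rw [one_mul, map_prod]
          refine Finset.prod_congr rfl fun j _ => ?_
          rw [b.repr_apply_apply, inner_conj_symm]
        rw [h3, map_smul, map_smul, hQ, lineProj_apply, h4]
        simp only [Finset.mem_univ, if_true, lineProj_apply]
        rw [productVector_smul]
        rfl
      simp only [h2]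
      exact h1.mapL _
    rw [this]
    rfl
  have hvac : Q (vacuum b Ω S) = vacuum b Ω S := by
    rw [vacuum, hQ]
    simp [lineProj_apply, hΩ]
  -- `Q` fixes the vacuum `v` and also maps it to `⟨v, v⟩ v`; as `v ≠ 0`, this forces `⟨v, v⟩ = 1`.
  have hnorm : ‖vacuum b Ω S‖ = 1 := by
    rw [hQx] at hvac
    have h1 : ⟪vacuum b Ω S, vacuum b Ω S⟫_ℂ = 1 := by
      have h2 := sub_eq_zero.2 hvac
      nth_rewrite 4 [← one_smul ℂ (vacuum b Ω S)] at h2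
      rw [← sub_smul, smul_eq_zero, or_iff_left (vacuum_ne_zero b hΩ)] at h2
      exact sub_eq_zero.1 h2
    have h2 := inner_self_eq_norm_sq (𝕜 := ℂ) (vacuum b Ω S)
    rw [h1] at h2
    have h3 : ‖vacuum b Ω S‖ ^ 2 = 1 := by simpa using h2.symm
    exact (pow_eq_one_iff_of_nonneg (norm_nonneg _) two_ne_zero).1 h3
  refine ⟨hnorm, fun ψ => ?_⟩
  have := hQ2 ψ
  rwa [hQx, norm_smul, hnorm, mul_one] at this

/-! ### The projections onto the vacuum -/

theorem slice_refl (g : ↥(S \ S) → ι) (ψ : TensorSpace ι S) :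
    slice (Finset.Subset.refl S) g ψ = ψ := by
  ext f
  change ψ (merge f g) = ψ f
  exact congrArg (fun f => ψ f) (funext fun j => merge_mem _ _ j.2)

theorem vacuumSubspace_refl : vacuumSubspace b Ω (Finset.Subset.refl S) = ℂ ∙ vacuum b Ω S := by
  ext ψ
  simp only [vacuumSubspace, Submodule.mem_iInf, Submodule.mem_comap, slice_refl]
  have : Nonempty (↥(S \ S) → ι) := ⟨fun j => absurd j.2 (by simp)⟩
  exact forall_const _

theorem vacuumProj_apply (hn : ‖vacuum b Ω S‖ = 1) (ψ : TensorSpace ι S) :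
    vacuumProj b Ω S ψ = ⟪vacuum b Ω S, ψ⟫_ℂ • vacuum b Ω S := by
  have h : (vacuumSubspace b Ω (Finset.Subset.refl S)).topologicalClosure =
      ℂ ∙ vacuum b Ω S := by
    rw [vacuumSubspace_refl]
    exact (Submodule.closed_of_finiteDimensional _).submodule_topologicalClosure_eq
  rw [vacuumProj, projMinus]
  simp only [h]
  exact Submodule.starProjection_unit_singleton ℂ hn ψ

theorem projMinus_vacuum (h : A ⊆ S) : projMinus b Ω h (vacuum b Ω S) = vacuum b Ω S := by
  rw [projMinus, Submodule.starProjection_eq_self_iff]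
  refine Submodule.le_topologicalClosure _ ?_
  simp only [vacuumSubspace, Submodule.mem_iInf, Submodule.mem_comap]
  intro g
  obtain ⟨c, hc⟩ := slice_vacuum_mem b (Ω := Ω) h g
  rw [hc]
  exact Submodule.smul_mem _ _ (Submodule.mem_span_singleton_self _)

end Vacuum

/-! ### Factoring the inverse square root through a smaller operator -/

section Factor

universe u v w
variable {γ : Type u} {K : Type v} {E : Type w} [NormedAddCommGroup K] [InnerProductSpace ℂ K]
  [NormedAddCommGroup E] [InnerProductSpace ℂ E] [CompleteSpace K]

/-- If `A ≥ 1 ⊗ A'`, then `(A + 1)^{-1/2} = (1 ⊗ (A' + 1)^{-1/2}) T` with a bounded operator `T`. -/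
theorem IsSlicing.exists_factor {s : γ → K →ₗ[ℂ] E} (hs : IsSlicing s) {A : K →ₗ.[ℂ] K}
    {R D : K →L[ℂ] K} (h : IsResolventSqrt A R D) {A' : E →ₗ.[ℂ] E} {R' D' : E →L[ℂ] E}
    (h' : IsResolventSqrt A' R' D')
    (hle : ∀ ψ η, (ψ, η) ∈ A.graph →
      ∃ a, (∀ g, (s g ψ, s g a) ∈ A'.graph) ∧ (⟪ψ, a⟫_ℂ).re ≤ (⟪ψ, η⟫_ℂ).re) :
    ∃ T : K →L[ℂ] K, (∀ y, hs.amp D' (T y) = D y) ∧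
      ∀ ψ a y, D y = ψ → (∀ g, (s g ψ, s g a) ∈ A'.graph) →
        ‖T y‖ ^ 2 = ‖ψ‖ ^ 2 + (⟪ψ, a⟫_ℂ).re := by
  set M := hs.amp D' with hM
  have hMs : ∀ x y, ⟪M x, y⟫_ℂ = ⟪x, M y⟫_ℂ := hs.amp_symm h'.symm
  have hMi : Function.Injective M := fun x y hxy => hs.ext fun g => h'.injective (by
    rw [← hs.slice_amp, ← hs.slice_amp, ← hM, hxy])
  have hMM : ∀ ψ a, (∀ g, (s g ψ, s g a) ∈ A'.graph) → ψ = M (M (a + ψ)) := by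
    intro ψ a hg
    refine hs.ext fun g => ?_
    have h1 := h'.isResolvent.mem_graph_iff.1 (hg g)
    rw [hM, hs.slice_amp, hs.slice_amp, h'.mul_self, map_add, ← h1]
  have hnorm : ∀ ψ a, (∀ g, (s g ψ, s g a) ∈ A'.graph) →
      ‖M (a + ψ)‖ ^ 2 = ‖ψ‖ ^ 2 + (⟪ψ, a⟫_ℂ).re := by
    intro ψ a hg
    have h1 : (⟪M (a + ψ), M (a + ψ)⟫_ℂ).re = ‖M (a + ψ)‖ ^ 2 :=
      inner_self_eq_norm_sq (𝕜 := ℂ) _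
    have h2 : (⟪ψ, ψ⟫_ℂ).re = ‖ψ‖ ^ 2 := inner_self_eq_norm_sq (𝕜 := ℂ) _
    rw [← h1, ← hMs, ← hMM ψ a hg, inner_add_right, Complex.add_re, h2, add_comm]
  -- Inversion reverses the order: `A ≥ 1 ⊗ A'` gives `D² ≤ M²`. With `ψ = R z`, `‖D z‖² = ⟨ψ, z⟩ =
  -- ⟨M (a + ψ), M z⟩ ≤ ‖D z‖ ‖M z‖` up to real parts.
  have hbd : ∀ z, ‖D z‖ ≤ 1 * ‖M z‖ := by
    intro z
    obtain ⟨a, ha, hle'⟩ := hle _ _ (h.isResolvent.apply_mem_graph z)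
    have h1 := hnorm _ _ ha
    have h2 : (⟪R z, R z⟫_ℂ).re = ‖R z‖ ^ 2 := inner_self_eq_norm_sq (𝕜 := ℂ) _
    have h3 : ‖M (a + R z)‖ ^ 2 ≤ ‖D z‖ ^ 2 := by
      rw [h1, h.norm_sq_apply]
      rw [inner_sub_right, Complex.sub_re, h2] at hle'
      linarith
    have h4 : ‖D z‖ ^ 2 ≤ ‖M (a + R z)‖ * ‖M z‖ := by
      rw [h.norm_sq_apply]
      nth_rewrite 1 [hMM _ _ ha]
      rw [hMs]
      exact re_inner_le_norm (𝕜 := ℂ) _ _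
    have h5 := (sq_le_sq₀ (norm_nonneg _) (norm_nonneg _)).1 h3
    rw [one_mul]
    rcases (norm_nonneg (D z)).eq_or_lt with h0 | h0
    · rw [← h0]; positivity
    · refine le_of_mul_le_mul_left ?_ h0
      rw [← sq]
      exact h4.trans (mul_le_mul_of_nonneg_right h5 (norm_nonneg _))
  -- `X` extends `D M⁻¹`. Taking adjoints in `X M = D` gives `M X* = D`, so `T = X*`.
  obtain ⟨X, hX⟩ := exists_extension D M (denseRange_of_symm_of_injective hMs hMi) 1 hbd
  have hT : ∀ y, M (X.adjoint y) = D y := fun y => ext_inner_left ℂ fun x => by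
    rw [← hMs, ContinuousLinearMap.adjoint_inner_right, hX, h.symm]
  refine ⟨X.adjoint, hT, fun ψ a y hy hg => ?_⟩
  have h1 : X.adjoint y = M (a + ψ) := hMi (by rw [hT, hy, ← hMM ψ a hg])
  rw [h1, hnorm ψ a hg]

end Factor

/-! ### The free Hamiltonian: resolvent, gap and energy counting -/

section FreeHamiltonian

universe u v
variable {𝓗 : Type u} [NormedAddCommGroup 𝓗] [InnerProductSpace ℂ 𝓗]
variable {ι : Type v} (b : HilbertBasis ι ℂ 𝓗) {A S : Finset ℕ} {Ω : 𝓗} {H : 𝓗 →ₗ.[ℂ] 𝓗}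

variable {R K : TensorSpace ι S →L[ℂ] TensorSpace ι S}

/-- In terms of `y = K z` and `ψ = K y`, the energies `e i = ⟨ψ, H_i ψ⟩` satisfy
`∑ e i = ‖y‖² - ‖ψ‖²`. -/
theorem exists_site_energies (h : IsResolventSqrt (freeHamiltonian b H S) R K)
    (z : TensorSpace ι S) : ∃ a : S → TensorSpace ι S,
      (∀ i, (R z, a i) ∈ (siteOperator b H S i).graph) ∧
      ∑ i, (⟪R z, a i⟫_ℂ).re = ‖K z‖ ^ 2 - ‖R z‖ ^ 2 := by
  obtain ⟨a, ha, ha'⟩ := (mem_graph_freeHamiltonian b H).1 (h.isResolvent.apply_mem_graph z)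
  refine ⟨a, ha, ?_⟩
  have h2 : (⟪R z, R z⟫_ℂ).re = ‖R z‖ ^ 2 := inner_self_eq_norm_sq (𝕜 := ℂ) _
  rw [h.norm_sq_apply, ← h2, ← Complex.sub_re, ← inner_sub_right, ha', inner_sum, Complex.re_sum]

variable [CompleteSpace 𝓗]

theorem IsSiteHamiltonian.nonempty_index (b : HilbertBasis ι ℂ 𝓗) (hH : IsSiteHamiltonian H Ω) : Nonempty ι := by
  by_contra hι
  rw [not_nonempty_iff] at hι
  have h1 : b.repr Ω = 0 := by
    ext n
    exact hι.elim n
  rw [LinearIsometryEquiv.map_eq_zero_iff] at h1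
  have h2 := hH.norm_vacuum
  simp [h1] at h2

/-- This is `H ≥ 1 - P_Ω` on all of `D(H)`: subtracting the vacuum component changes neither `H x`,
since `H Ω = 0`, nor the energy, since `H x ⊥ Ω` by symmetry. The gap then applies to the remainder.
-/
theorem IsSiteHamiltonian.lineProj_le (hH : IsSiteHamiltonian H Ω) {x y : 𝓗}
    (h : (x, y) ∈ H.graph) : ‖x‖ ^ 2 - ‖lineProj Ω x‖ ^ 2 ≤ (⟪x, y⟫_ℂ).re := by
  have hΩ := hH.norm_vacuum
  have h1 : (x - lineProj Ω x, y) ∈ H.graph := by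
    have := H.graph.sub_mem h (H.graph.smul_mem ⟪Ω, x⟫_ℂ hH.vacuum)
    simpa [lineProj_apply] using this
  have h2 : ⟪Ω, y⟫_ℂ = 0 := by
    have := (hH.selfAdjoint.mem_graph_iff).1 h _ _ hH.vacuum
    rw [← this, inner_zero_left]
  have h3 : ⟪Ω, x - lineProj Ω x⟫_ℂ = 0 := by
    simp [lineProj_apply, hΩ]
  obtain ⟨z, hz, hz'⟩ := (LinearPMap.mem_graph_iff _).1 h1
  dsimp only at hz hz'
  have h4 := hH.gap z (by rw [hz, h3])
  rw [hz, hz', norm_sq_sub_lineProj hΩ, inner_sub_left, lineProj_apply, inner_smul_left, h2,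
    mul_zero, sub_zero] at h4
  exact h4

theorem IsSiteHamiltonian.siteOperator_le (hH : IsSiteHamiltonian H Ω) [Nonempty ι] {i : S}
    {ψ η : TensorSpace ι S} (h : (ψ, η) ∈ (siteOperator b H S i).graph) :
    ‖ψ‖ ^ 2 - ‖siteAmp b i (lineProj Ω) ψ‖ ^ 2 ≤ (⟪ψ, η⟫_ℂ).re := by
  have hs := isSlicing_siteSlice b i (Classical.arbitrary ι)
  refine hasSum_le (fun g => ?_)
    ((hs.hasSum_norm_sq ψ).sub (hs.hasSum_norm_sq (siteAmp b i (lineProj Ω) ψ)))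
    (Complex.hasSum_re (hs.hasSum_inner ψ η))
  rw [siteSlice_siteAmp]
  exact hH.lineProj_le ((mem_graph_siteOperator b H i).1 h g.1)

theorem IsSiteHamiltonian.siteOperator_nonneg (hH : IsSiteHamiltonian H Ω) [Nonempty ι] {i : S}
    {ψ η : TensorSpace ι S} (h : (ψ, η) ∈ (siteOperator b H S i).graph) :
    0 ≤ (⟪ψ, η⟫_ℂ).re := by
  refine le_trans ?_ (hH.siteOperator_le b h)
  have hs := isSlicing_siteSlice b i (Classical.arbitrary ι)
  rw [sub_nonneg]
  refine hasSum_le (fun g => ?_) (hs.hasSum_norm_sq (siteAmp b i (lineProj Ω) ψ))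
    (hs.hasSum_norm_sq ψ)
  rw [siteSlice_siteAmp]
  linarith [norm_sq_sub_lineProj hH.norm_vacuum (siteSlice b i g.1 ψ),
    sq_nonneg ‖siteSlice b i g.1 ψ - lineProj Ω (siteSlice b i g.1 ψ)‖]

theorem IsSiteHamiltonian.norm_vacuum_eq (hH : IsSiteHamiltonian H Ω) (S : Finset ℕ) :
    ‖QuantumChain.vacuum b Ω S‖ = 1 :=
  have := hH.nonempty_index b
  (exists_vacuum_bound b hH.norm_vacuum).1

/-- The free Hamiltonian is a non-negative self-adjoint operator. -/
theorem IsSiteHamiltonian.exists_isResolventSqrt (hH : IsSiteHamiltonian H Ω) (S : Finset ℕ) :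
    ∃ R K, IsResolventSqrt (freeHamiltonian b H S) R K := by
  have := hH.nonempty_index b
  obtain ⟨R, hR, hR'⟩ := exists_isResolvent_of_isSelfAdjoint hH.selfAdjoint hH.nonneg
  obtain ⟨C, hC, hC', -⟩ := exists_isResolvent_sum (fun i : S => siteOperator b H S i)
    (fun i => siteAmp b i R) (isResolvent_siteAmp b hR)
    (fun i => IsSlicing.isNonnegResolvent_amp _ hR')
    (fun i j => by
      rcases eq_or_ne i j with rfl | hij
      · exact Commute.refl _
      · exact siteAmp_commute b hij R R) Finset.univ
  obtain ⟨K, hK⟩ := QuantumChain.exists_isResolventSqrt hC hC'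
  exact ⟨C, K, hK⟩

theorem IsSiteHamiltonian.vacuum_mem_graph (hH : IsSiteHamiltonian H Ω) (S : Finset ℕ) :
    (QuantumChain.vacuum b Ω S, 0) ∈ (freeHamiltonian b H S).graph := by
  have := hH.nonempty_index b
  rw [mem_graph_freeHamiltonian]
  refine ⟨fun _ => 0, fun i => ?_, by simp⟩
  rw [mem_graph_siteOperator]
  intro g
  obtain ⟨c, hc⟩ := siteSlice_vacuum_mem b (Ω := Ω) i g
  rw [hc, map_zero]
  simpa using H.graph.smul_mem c hH.vacuum

/-- From `K² v = v`, the vector `y = K v - v` satisfies `K y = -y`, which is incompatible with `K ≥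
0` unless `y = 0`. -/
theorem IsSiteHamiltonian.sqrt_vacuum (hH : IsSiteHamiltonian H Ω)
    (h : IsResolventSqrt (freeHamiltonian b H S) R K) : K (QuantumChain.vacuum b Ω S) = QuantumChain.vacuum b Ω S := by
  have h1 := h.isResolvent.mem_graph_iff.1 (hH.vacuum_mem_graph b S)
  rw [zero_add] at h1
  set v := QuantumChain.vacuum b Ω S
  set y := K v - v with hy
  have h2 : K y = -y := by rw [hy, map_sub, h.mul_self, ← h1]; abel
  have h3 := re_inner_nonneg h.nonneg y
  have h4 : (⟪y, y⟫_ℂ).re = ‖y‖ ^ 2 := inner_self_eq_norm_sq (𝕜 := ℂ) _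
  rw [h2, inner_neg_left, Complex.neg_re, h4] at h3
  have h5 : ‖y‖ = 0 := by nlinarith [norm_nonneg y]
  exact sub_eq_zero.1 (norm_eq_zero.1 h5)

theorem IsSiteHamiltonian.inner_vacuum_sqrt (hH : IsSiteHamiltonian H Ω)
    (h : IsResolventSqrt (freeHamiltonian b H S) R K) (y : TensorSpace ι S) :
    ⟪QuantumChain.vacuum b Ω S, K y⟫_ℂ = ⟪QuantumChain.vacuum b Ω S, y⟫_ℂ := by
  rw [← h.symm, hH.sqrt_vacuum b h]

/-- The free Hamiltonian is at least `1` on the orthogonal complement of the vacuum. -/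
theorem IsSiteHamiltonian.sqrt_gap (hH : IsSiteHamiltonian H Ω)
    (h : IsResolventSqrt (freeHamiltonian b H S) R K) {y : TensorSpace ι S}
    (hy : ⟪QuantumChain.vacuum b Ω S, y⟫_ℂ = 0) : 2 * ‖K y‖ ^ 2 ≤ ‖y‖ ^ 2 := by
  have := hH.nonempty_index b
  -- Keeping the vacuum component makes this a closed condition on all `y`, so it suffices to take
  -- `y = K z`, where `K y = R z` lies in the domain of every `H_i`.
  have key : ∀ y, 2 * ‖K y‖ ^ 2 ≤ ‖y‖ ^ 2 + ‖⟪QuantumChain.vacuum b Ω S, y⟫_ℂ‖ ^ 2 := by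
    intro y
    refine h.denseRange.induction_on y (isClosed_le (by fun_prop) (by fun_prop)) fun z => ?_
    obtain ⟨a, ha, ha'⟩ := exists_site_energies b h z
    have h1 := (exists_vacuum_bound (S := S) b hH.norm_vacuum).2 (R z)
    have h2 := Finset.sum_le_sum fun i (_ : i ∈ Finset.univ) => hH.siteOperator_le b (ha i)
    have h3 : ⟪QuantumChain.vacuum b Ω S, R z⟫_ℂ = ⟪QuantumChain.vacuum b Ω S, K z⟫_ℂ := by
      rw [← h.mul_self, hH.inner_vacuum_sqrt b h]
    rw [h.mul_self]
    rw [h3] at h1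
    linarith
  have := key y
  rw [hy] at this
  simpa using this

/-- The form of the part of the free Hamiltonian in `A ⊆ S`: `(H⁰_S + 1)^{-1/2}` is
`(1 ⊗ (H⁰_A + 1)^{-1/2}) T` with a bounded `T`. -/
theorem IsSiteHamiltonian.exists_factor (hH : IsSiteHamiltonian H Ω) (hA : A ⊆ S)
    (h : IsResolventSqrt (freeHamiltonian b H S) R K) {R' K' : TensorSpace ι A →L[ℂ] TensorSpace ι A}
    (h' : IsResolventSqrt (freeHamiltonian b H A) R' K') :
    ∃ T : TensorSpace ι S →L[ℂ] TensorSpace ι S, (∀ y, (isSlicing_slice hA).amp K' (T y) = K y) ∧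
      ∀ y ψ (a : S → TensorSpace ι S), K y = ψ →
        (∀ i, (ψ, a i) ∈ (siteOperator b H S i).graph) →
        ‖T y‖ ^ 2 = ‖ψ‖ ^ 2 + ∑ i : S, if (i : ℕ) ∈ A then (⟪ψ, a i⟫_ℂ).re else 0 := by
  have := hH.nonempty_index b
  have hgraph : ∀ ψ (a : S → TensorSpace ι S),
      (∀ i, (ψ, a i) ∈ (siteOperator b H S i).graph) → ∀ g,
      (slice hA g ψ, slice hA g (∑ i : A, a ⟨i, hA i.2⟩)) ∈ (freeHamiltonian b H A).graph := by
    intro ψ a ha g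
    rw [mem_graph_freeHamiltonian]
    exact ⟨fun i => slice hA g (a ⟨i, hA i.2⟩),
      fun i => slice_mem_graph_siteOperator b H hA i (ha _) g, map_sum _ _ _⟩
  have hsum : ∀ ψ (a : S → TensorSpace ι S), (⟪ψ, ∑ i : A, a ⟨i, hA i.2⟩⟫_ℂ).re =
      ∑ i : S, if (i : ℕ) ∈ A then (⟪ψ, a i⟫_ℂ).re else 0 := by
    intro ψ a
    rw [inner_sum, Complex.re_sum, ← Finset.sum_filter]
    refine Finset.sum_bij (fun i _ => ⟨i, hA i.2⟩) (fun i _ => by simp) (fun i _ j _ hij => ?_)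
      (fun j hj => ⟨⟨j, by simpa using hj⟩, Finset.mem_univ _, rfl⟩) fun i _ => rfl
    exact Subtype.ext (congrArg (fun x : S => (x : ℕ)) hij)
  obtain ⟨T, hT, hT'⟩ := (isSlicing_slice hA).exists_factor h h' fun ψ η hψ => by
    obtain ⟨a, ha, rfl⟩ := (mem_graph_freeHamiltonian b H).1 hψ
    refine ⟨_, hgraph ψ a ha, ?_⟩
    rw [hsum, inner_sum, Complex.re_sum]
    refine Finset.sum_le_sum fun i _ => ?_
    split_ifs
    · exact le_rfl
    · exact hH.siteOperator_nonneg b (ha i)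
  refine ⟨T, hT, fun y ψ a hy ha => ?_⟩
  rw [hT' ψ _ y hy (hgraph ψ a ha), hsum]

/-- A weighted family of subsets `A p` of `S` that covers every site with total weight at most `C`
has `∑ c p H⁰_{A p} ≤ C H⁰_S`. -/
theorem IsSiteHamiltonian.sum_factor_le (hH : IsSiteHamiltonian H Ω)
    (h : IsResolventSqrt (freeHamiltonian b H S) R K) {P : Type*} [Fintype P] (A : P → Finset ℕ)
    (T : P → TensorSpace ι S →L[ℂ] TensorSpace ι S)
    (hT : ∀ p y ψ (a : S → TensorSpace ι S), K y = ψ →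
        (∀ i, (ψ, a i) ∈ (siteOperator b H S i).graph) →
        ‖T p y‖ ^ 2 = ‖ψ‖ ^ 2 + ∑ i : S, if (i : ℕ) ∈ A p then (⟪ψ, a i⟫_ℂ).re else 0)
    (c : P → ℝ) (C : ℝ) (hC : ∀ i : S, (∑ p, if (i : ℕ) ∈ A p then c p else 0) ≤ C)
    (y : TensorSpace ι S) :
    ∑ p, c p * (‖T p y‖ ^ 2 - ‖K y‖ ^ 2) ≤ C * (‖y‖ ^ 2 - ‖K y‖ ^ 2) := by
  have := hH.nonempty_index b
  -- By density `y = K z`; then `K y = R z` has well-defined site energies, and interchanging the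
  -- sums over `p` and `i` leaves the covering weights.
  refine h.denseRange.induction_on y (isClosed_le (by fun_prop) (by fun_prop)) fun z => ?_
  obtain ⟨a, ha, ha'⟩ := exists_site_energies b h z
  have h1 : ∀ p, ‖T p (K z)‖ ^ 2 - ‖K (K z)‖ ^ 2 =
      ∑ i : S, if (i : ℕ) ∈ A p then (⟪R z, a i⟫_ℂ).re else 0 := fun p => by
    rw [hT p (K z) (R z) a (h.mul_self z) ha, h.mul_self, add_sub_cancel_left]
  simp only [h1]
  rw [h.mul_self, ← ha', Finset.mul_sum]
  simp only [Finset.mul_sum]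
  rw [Finset.sum_comm]
  refine Finset.sum_le_sum fun i _ => ?_
  have h2 : ∑ p, c p * (if (i : ℕ) ∈ A p then (⟪R z, a i⟫_ℂ).re else 0) =
      (∑ p, if (i : ℕ) ∈ A p then c p else 0) * (⟪R z, a i⟫_ℂ).re := by
    rw [Finset.sum_mul]
    refine Finset.sum_congr rfl fun p _ => ?_
    split_ifs <;> simp
  rw [h2]
  exact mul_le_mul_of_nonneg_right (hC i) (hH.siteOperator_nonneg b (ha i))

end FreeHamiltonian

/-! ### Potentials as bounded operators, and their lower bound -/

section Potentials

universe u v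
variable {𝓗 : Type u} [NormedAddCommGroup 𝓗] [InnerProductSpace ℂ 𝓗]
variable {ι : Type v} {b : HilbertBasis ι ℂ 𝓗} {A S : Finset ℕ} {Ω : 𝓗} {H : 𝓗 →ₗ.[ℂ] 𝓗}
variable {R K : TensorSpace ι A →L[ℂ] TensorSpace ι A}

theorem inner_sub_lineProj_eq_zero {E : Type*} [NormedAddCommGroup E] [InnerProductSpace ℂ E]
    {v : E} (hv : ‖v‖ = 1) (x : E) : ⟪v, x - lineProj v x⟫_ℂ = 0 := by
  simp [lineProj_apply, hv]

theorem Potential.operator_symm {V : Potential b H A} (hV : V.Symmetric)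
    (h : IsResolventSqrt (freeHamiltonian b H A) R K) {B : TensorSpace ι A →L[ℂ] TensorSpace ι A}
    (hB : ∀ φ ψ, V.eval (K φ) (K ψ) = ⟪φ, B ψ⟫_ℂ) (φ ψ : TensorSpace ι A) :
    ⟪B φ, ψ⟫_ℂ = ⟪φ, B ψ⟫_ℂ := by
  have hev : ∀ φ ψ, V.eval (K φ) (K ψ) =
      V ⟨K φ, h.apply_mem_formDomain φ⟩ ⟨K ψ, h.apply_mem_formDomain ψ⟩ := fun φ ψ =>
    dif_pos ⟨h.apply_mem_formDomain φ, h.apply_mem_formDomain ψ⟩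
  rw [← inner_conj_symm, ← hB, ← hB, hev, hev, hV ⟨K φ, _⟩]

variable [CompleteSpace 𝓗]

/-- The vacuum projection commutes with `K`; this carries the block structure of `V` over to `B`. -/
theorem vacuumProj_sqrt (hH : IsSiteHamiltonian H Ω)
    (h : IsResolventSqrt (freeHamiltonian b H A) R K) (y : TensorSpace ι A) :
    vacuumProj b Ω A (K y) = K (lineProj (vacuum b Ω A) y) := by
  rw [vacuumProj_apply b (hH.norm_vacuum_eq b A), lineProj_apply, map_smul, hH.sqrt_vacuum b h,
    hH.inner_vacuum_sqrt b h]

theorem vacuumProjCompl_sqrt (hH : IsSiteHamiltonian H Ω)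
    (h : IsResolventSqrt (freeHamiltonian b H A) R K) (y : TensorSpace ι A) :
    vacuumProjCompl b Ω A (K y) = K (y - lineProj (vacuum b Ω A) y) := by
  rw [map_sub, ← vacuumProj_sqrt hH h]
  rfl

theorem Potential.operator_blockDiagonal (hH : IsSiteHamiltonian H Ω) {V : Potential b H A}
    (hV : V.BlockDiagonal Ω) (h : IsResolventSqrt (freeHamiltonian b H A) R K)
    {B : TensorSpace ι A →L[ℂ] TensorSpace ι A}
    (hB : ∀ φ ψ, V.eval (K φ) (K ψ) = ⟪φ, B ψ⟫_ℂ) (φ ψ : TensorSpace ι A) :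
    ⟪φ, B ψ⟫_ℂ = ⟪φ - lineProj (vacuum b Ω A) φ, B (ψ - lineProj (vacuum b Ω A) ψ)⟫_ℂ +
      ⟪lineProj (vacuum b Ω A) φ, B (lineProj (vacuum b Ω A) ψ)⟫_ℂ := by
  rw [← hB, hV _ (h.apply_mem_formDomain φ) _ (h.apply_mem_formDomain ψ),
    vacuumProjCompl_sqrt hH h, vacuumProjCompl_sqrt hH h, vacuumProj_sqrt hH h,
    vacuumProj_sqrt hH h, hB, hB]

/-- Without off-diagonal blocks, `B v` has no component orthogonal to `v`. Symmetry makes `⟨v, B v⟩`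
real, so the real part in `Potential.expectation` loses nothing. -/
theorem Potential.operator_vacuum (hH : IsSiteHamiltonian H Ω) {V : Potential b H A}
    (hV : V.Symmetric) (hV' : V.BlockDiagonal Ω)
    (h : IsResolventSqrt (freeHamiltonian b H A) R K)
    {B : TensorSpace ι A →L[ℂ] TensorSpace ι A}
    (hB : ∀ φ ψ, V.eval (K φ) (K ψ) = ⟪φ, B ψ⟫_ℂ) :
    B (vacuum b Ω A) = (V.expectation Ω : ℂ) • vacuum b Ω A := by
  have hn := hH.norm_vacuum_eq b A
  set v := vacuum b Ω A with hv
  have hvv : lineProj v v = v := by simp [lineProj_apply, hn]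
  have he : (V.expectation Ω : ℂ) = ⟪v, B v⟫_ℂ := by
    have h1 : conj ⟪v, B v⟫_ℂ = ⟪v, B v⟫_ℂ := by
      rw [inner_conj_symm, operator_symm hV h hB]
    rw [← Complex.conj_eq_iff_re.1 h1, Potential.expectation, ← hv, ← hB, hH.sqrt_vacuum b h]
  refine ext_inner_left ℂ fun φ => ?_
  rw [operator_blockDiagonal hH hV' h hB φ v, ← hv, hvv, sub_self, map_zero, inner_zero_right,
    zero_add, lineProj_apply, inner_smul_left, inner_conj_symm, inner_smul_right, he, mul_comm]

/-- `V - ⟨V⟩ ≥ -3 c H⁰_A` for a block-diagonal potential of weighted norm at most `c`. -/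
theorem Potential.operator_lower_bound (hH : IsSiteHamiltonian H Ω) {V : Potential b H A}
    (hV : V.Symmetric) (hV' : V.BlockDiagonal Ω)
    (h : IsResolventSqrt (freeHamiltonian b H A) R K)
    {B : TensorSpace ι A →L[ℂ] TensorSpace ι A}
    (hB : ∀ φ ψ, V.eval (K φ) (K ψ) = ⟪φ, B ψ⟫_ℂ) {c : ℝ} (hc : ‖B‖ ≤ c)
    (y : TensorSpace ι A) :
    -(3 * c) * (‖y‖ ^ 2 - ‖K y‖ ^ 2) ≤
      (⟪y, B y⟫_ℂ).re - V.expectation Ω * ‖K y‖ ^ 2 := by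
  have hn := hH.norm_vacuum_eq b A
  have hBv := operator_vacuum hH hV hV' h hB
  have hbd := operator_blockDiagonal hH hV' h hB y y
  have hKy : lineProj (vacuum b Ω A) (K y) = K (lineProj (vacuum b Ω A) y) := by
    rw [← vacuumProj_sqrt hH h, vacuumProj_apply b hn, lineProj_apply]
  have hKv := hH.sqrt_vacuum b h
  set v := vacuum b Ω A with hv
  set e := V.expectation Ω with he
  set z := y - lineProj v y with hz
  have hzv : ⟪v, z⟫_ℂ = 0 := inner_sub_lineProj_eq_zero hn y
  have hc0 : 0 ≤ c := (norm_nonneg _).trans hc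
  have h1 : ‖z‖ ^ 2 = ‖y‖ ^ 2 - ‖lineProj v y‖ ^ 2 := norm_sq_sub_lineProj hn y
  have h2 : ‖K z‖ ^ 2 = ‖K y‖ ^ 2 - ‖lineProj v y‖ ^ 2 := by
    have h3 := norm_sq_sub_lineProj hn (K y)
    rw [hKy, ← map_sub, ← hz] at h3
    rw [h3, lineProj_apply, map_smul, hKv]
  have h3 : ⟪lineProj v y, B (lineProj v y)⟫_ℂ = ((e * ‖lineProj v y‖ ^ 2 : ℝ) : ℂ) := by
    have : B (lineProj v y) = (e : ℂ) • lineProj v y := by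
      rw [lineProj_apply, map_smul, hBv, smul_comm]
    rw [this, inner_smul_right, inner_self_eq_norm_sq_to_K]
    push_cast
    rfl
  have habs : ∀ x, |(⟪x, B x⟫_ℂ).re| ≤ c * ‖x‖ ^ 2 := fun x => by
    refine (Complex.abs_re_le_norm _).trans ((norm_inner_le_norm _ _).trans ?_)
    have := (B.le_opNorm x).trans (mul_le_mul_of_nonneg_right hc (norm_nonneg x))
    nlinarith [norm_nonneg x]
  have h4 := (abs_le.1 (habs z)).1
  have h5 : e ≤ c := by
    have h6 := (abs_le.1 (habs v)).2
    rw [hBv, inner_smul_right, inner_self_eq_norm_sq_to_K, hn] at h6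
    simpa using h6
  have hgap := hH.sqrt_gap b h hzv
  rw [hbd, Complex.add_re, h3, Complex.ofReal_re]
  -- The vacuum component cancels on both sides. With `h = ‖z‖² - ‖K z‖²`, the gap says `‖K z‖² ≤
  -- h`, so `c ‖z‖² + e ‖K z‖² ≤ c h + 2 c ‖K z‖² ≤ 3 c h`.
  have e1 : ‖y‖ ^ 2 - ‖K y‖ ^ 2 = ‖z‖ ^ 2 - ‖K z‖ ^ 2 := by rw [h1, h2]; ring
  have e2 : ‖K y‖ ^ 2 = ‖K z‖ ^ 2 + ‖lineProj v y‖ ^ 2 := by rw [h2]; ring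
  rw [e1, e2]
  nlinarith [mul_le_mul_of_nonneg_left hgap hc0,
    mul_le_mul_of_nonneg_right h5 (sq_nonneg ‖K z‖)]

/-- The form of `V ⊗ 1` on `D((H⁰_S)^{1/2})` in terms of bounded operators. -/
theorem Potential.exists_ampliation_operator (hH : IsSiteHamiltonian H Ω) (hA : A ⊆ S)
    {R K : TensorSpace ι S →L[ℂ] TensorSpace ι S}
    (h : IsResolventSqrt (freeHamiltonian b H S) R K) {V : Potential b H A}
    (hV : V.Symmetric) (hV' : V.BlockDiagonal Ω) {c : ℝ} (hc : V.WeightedNormLE c) :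
    ∃ W T : TensorSpace ι S →L[ℂ] TensorSpace ι S,
      (∀ x y, ⟪W x, y⟫_ℂ = ⟪x, W y⟫_ℂ) ∧
      W (vacuum b Ω S) = (V.expectation Ω : ℂ) • vacuum b Ω S ∧
      (∀ x y, V.ampliation hA (K x) (K y) = ⟪x, W y⟫_ℂ) ∧
      (∀ y ψ (a : S → TensorSpace ι S), K y = ψ →
        (∀ i, (ψ, a i) ∈ (siteOperator b H S i).graph) →
        ‖T y‖ ^ 2 = ‖ψ‖ ^ 2 + ∑ i : S, if (i : ℕ) ∈ A then (⟪ψ, a i⟫_ℂ).re else 0) ∧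
      ∀ y, -(3 * c) * (‖T y‖ ^ 2 - ‖K y‖ ^ 2) ≤
        (⟪W y, y⟫_ℂ).re - V.expectation Ω * ‖K y‖ ^ 2 := by
  obtain ⟨R', K', h'⟩ := hH.exists_isResolventSqrt b A
  obtain ⟨B, hBc, hB⟩ := hc
  rw [h'.invSqrtAddOne_eq] at hB
  obtain ⟨T, hT, hT'⟩ := hH.exists_factor b hA h h'
  have hs := isSlicing_slice (ι := ι) hA
  have hBs := operator_symm hV h' hB
  have hBv := operator_vacuum hH hV hV' h' hB
  -- Since `K = (1 ⊗ K') T`, sandwiching `V ⊗ 1` between two `K` gives `W = T* (1 ⊗ B) T`.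
  have hin : ∀ x y, ⟪x, (T.adjoint * hs.amp B * T) y⟫_ℂ = ⟪T x, hs.amp B (T y)⟫_ℂ := fun x y => by
    rw [mul_apply_eq_comp, mul_apply_eq_comp, ContinuousLinearMap.adjoint_inner_right]
  have hslK : ∀ x g, slice hA g (K x) = K' (slice hA g (T x)) := fun x g => by
    rw [← hT, hs.slice_amp]
  have hWs : ∀ x y, ⟪(T.adjoint * hs.amp B * T) x, y⟫_ℂ =
      ⟪x, (T.adjoint * hs.amp B * T) y⟫_ℂ := fun x y => by
    rw [← inner_conj_symm, hin, hin, ← hs.amp_symm hBs, inner_conj_symm]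
  refine ⟨T.adjoint * hs.amp B * T, T, hWs, ?_, fun x y => ?_, hT', fun y => ?_⟩
  · have hamp : ∀ (D : TensorSpace ι A →L[ℂ] TensorSpace ι A) (d : ℂ),
        D (vacuum b Ω A) = d • vacuum b Ω A → hs.amp D (vacuum b Ω S) = d • vacuum b Ω S := by
      intro D d hD
      refine hs.ext fun g => ?_
      obtain ⟨a, ha⟩ := slice_vacuum_mem b (Ω := Ω) hA g
      rw [hs.slice_amp, map_smul, ha, map_smul, hD, smul_comm]
    have hK'v : hs.amp K' (vacuum b Ω S) = vacuum b Ω S := by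
      simpa using hamp K' 1 (by rw [one_smul]; exact hH.sqrt_vacuum b h')
    have hTv : T (vacuum b Ω S) = vacuum b Ω S := by
      refine hs.ext fun g => h'.injective ?_
      rw [← hslK, hH.sqrt_vacuum b h, ← hs.slice_amp, hK'v]
    refine ext_inner_left ℂ fun x => ?_
    rw [hin, hTv, hamp B _ hBv, inner_smul_right, inner_smul_right]
    congr 1
    -- Writing `v = (1 ⊗ K') v` turns `⟨T x, v⟩` into `⟨K x, v⟩ = ⟨x, v⟩`.
    nth_rewrite 1 [← hK'v]
    rw [← hs.amp_symm h'.symm, hT, h.symm, hH.sqrt_vacuum b h]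
  · rw [hin, Potential.ampliation]
    simp only [hslK, hB]
    simpa only [hs.slice_amp] using (hs.hasSum_inner (T x) (hs.amp B (T y))).tsum_eq
  · rw [hWs, hin]
    have h1 := hs.hasSum_norm_sq (T y)
    have h2 := hs.hasSum_norm_sq (K y)
    have h3 := Complex.hasSum_re (hs.hasSum_inner (T y) (hs.amp B (T y)))
    refine hasSum_le (fun g => ?_) ((h1.sub h2).mul_left (-(3 * c)))
      (h3.sub (h2.mul_left (V.expectation Ω)))
    rw [hslK, hs.slice_amp]
    exact operator_lower_bound hH hV hV' h' hB hBc _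

end Potentials

/-! ### The constant `c(t)` and the counting of intervals -/

section Constants

/-- The weight `(n + 3) t^{(n + 1) / 4}` in terms of `r = t^{1/4}`. -/
theorem gapConstant_term (t : ℝ) (ht : 0 < t) (n : ℕ) :
    ((n + 3 : ℕ) : ℝ) * t ^ ((((n + 3 : ℕ) : ℝ) - 2) / 4) =
      ((n : ℝ) + 3) * (t ^ (1 / 4 : ℝ)) ^ (n + 1) := by
  rw [← Real.rpow_natCast, ← Real.rpow_mul ht.le]
  push_cast
  congr 2
  ring

theorem summable_add_three_mul_pow {r : ℝ} (h0 : 0 ≤ r) (h1 : r < 1) :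
    Summable fun n : ℕ => ((n : ℝ) + 3) * r ^ (n + 1) := by
  have hr : ‖r‖ < 1 := by rwa [Real.norm_of_nonneg h0]
  have h2 := summable_pow_mul_geometric_of_norm_lt_one 1 hr
  have h3 := ((h2.add ((summable_geometric_of_lt_one h0 h1).mul_left 3)).mul_left r)
  refine h3.congr fun n => ?_
  ring

theorem summable_gapConstant {t : ℝ} (ht : 0 < t) (ht1 : t < 1) :
    Summable fun n : ℕ => ((n + 3 : ℕ) : ℝ) * t ^ ((((n + 3 : ℕ) : ℝ) - 2) / 4) := by
  simp only [gapConstant_term t ht]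
  exact summable_add_three_mul_pow (by positivity) (Real.rpow_lt_one ht.le ht1 (by norm_num))

/-- Only the sign of the series is used, so the argument also covers a divergent series, whose
`tsum` is `0` by default: already `8t < 1`. -/
theorem lt_one_of_gapConstant_pos {t : ℝ} (ht : 0 < t) (h : 0 < gapConstant t) : t < 1 := by
  have h1 : 0 ≤ ∑' n : ℕ, ((n + 3 : ℕ) : ℝ) * t ^ ((((n + 3 : ℕ) : ℝ) - 2) / 4) :=
    tsum_nonneg fun n => by positivity
  rw [gapConstant] at h
  nlinarith [mul_nonneg ht.le h1]

/-- For `t ≤ 1/16` one has `t^{1/4} ≤ 1/2`, and the series is at most `∑ (n + 3) 2^{-(n+1)} = 4`.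
Hence `c(t) ≥ 1 - 24 t`. -/
theorem half_le_gapConstant {t : ℝ} (ht : 0 < t) (ht' : t < 1 / 48) : 1 / 2 ≤ gapConstant t := by
  have hr : t ^ (1 / 4 : ℝ) ≤ 1 / 2 := by
    have h1 : (1 / 2 : ℝ) = ((1 / 16 : ℝ)) ^ (1 / 4 : ℝ) := by
      rw [show (1 / 16 : ℝ) = (1 / 2) ^ (4 : ℝ) by norm_num, ← Real.rpow_mul (by norm_num)]
      norm_num
    rw [h1]
    exact Real.rpow_le_rpow ht.le (by linarith) (by norm_num)
  have hhalf : HasSum (fun n : ℕ => ((n : ℝ) + 3) * (1 / 2) ^ (n + 1)) 4 := by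
    have h1 := hasSum_coe_mul_geometric_of_norm_lt_one (r := (1 / 2 : ℝ)) (by norm_num)
    have h2 := hasSum_geometric_of_lt_one (r := (1 / 2 : ℝ)) (by norm_num) (by norm_num)
    have h3 := (h1.add (h2.mul_left 3)).mul_left (1 / 2)
    have h4 : (1 / 2 : ℝ) * (1 / 2 / (1 - 1 / 2) ^ 2 + 3 * (1 - 1 / 2)⁻¹) = 4 := by norm_num
    rw [h4] at h3
    refine h3.congr_fun fun n => ?_
    ring
  have hle : ∑' n : ℕ, ((n + 3 : ℕ) : ℝ) * t ^ ((((n + 3 : ℕ) : ℝ) - 2) / 4) ≤ 4 := by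
    refine hasSum_le (fun n => ?_) (summable_gapConstant ht (by linarith)).hasSum hhalf
    rw [gapConstant_term t ht]
    gcongr
  rw [gapConstant]
  nlinarith

/-- Every site of `I_{k,q}` is covered by the intervals `I_{l,i}`, `1 ≤ l ≤ k - 1`, with total weight
at most `1 - c(t)`. -/
theorem sum_weights_le {t : ℝ} (ht : 0 < t) (ht1 : t < 1) (k q i : ℕ) :
    (∑ p : subIntervals k q, if i ∈ interval p.1.1 p.1.2 then
      t * (3 * t ^ (((p.1.1 : ℝ) - 1) / 4)) else 0) ≤ 1 - gapConstant t := by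
  have h1 : (∑ p : subIntervals k q, if i ∈ interval p.1.1 p.1.2 then
      t * (3 * t ^ (((p.1.1 : ℝ) - 1) / 4)) else 0) =
      ∑ p ∈ subIntervals k q, if i ∈ interval p.1 p.2 then
        t * (3 * t ^ (((p.1 : ℝ) - 1) / 4)) else 0 :=
    Finset.sum_coe_sort (subIntervals k q) fun p => if i ∈ interval p.1 p.2 then
        t * (3 * t ^ (((p.1 : ℝ) - 1) / 4)) else 0
  have h2 : (∑ p ∈ subIntervals k q, if i ∈ interval p.1 p.2 then
        t * (3 * t ^ (((p.1 : ℝ) - 1) / 4)) else 0) ≤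
      ∑ l ∈ Finset.Icc 1 (k - 1), ∑ j ∈ Finset.Icc q (q + k), if i ∈ interval l j then
        t * (3 * t ^ (((l : ℝ) - 1) / 4)) else 0 := by
    rw [← Finset.sum_product (f := fun p : ℕ × ℕ => if i ∈ interval p.1 p.2 then
        t * (3 * t ^ (((p.1 : ℝ) - 1) / 4)) else 0)]
    refine Finset.sum_le_sum_of_subset_of_nonneg (Finset.filter_subset _ _) fun p _ _ => ?_
    split_ifs <;> positivity
  have h3 : ∀ l, (∑ j ∈ Finset.Icc q (q + k), if i ∈ interval l j then
        t * (3 * t ^ (((l : ℝ) - 1) / 4)) else 0) ≤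
      4 * t * (((l : ℝ) + 1) * t ^ (((l : ℝ) - 1) / 4)) := by
    intro l
    rw [← Finset.sum_filter, Finset.sum_const, nsmul_eq_mul]
    -- The left endpoint of an interval of length `l` containing `i` lies in `{i - l, …, i}`.
    have hcard : ((Finset.Icc q (q + k)).filter fun j => i ∈ interval l j).card ≤ l + 1 := by
      refine (Finset.card_le_card (t := Finset.Icc (i - l) i) fun j hj => ?_).trans ?_
      · simp only [interval, Finset.mem_filter, Finset.mem_Icc] at hj ⊢
        omega
      · rw [Nat.card_Icc]
        omega
    have hcard' : (((Finset.Icc q (q + k)).filter fun j => i ∈ interval l j).card : ℝ) ≤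
        (l : ℝ) + 1 := by exact_mod_cast hcard
    have hp : 0 ≤ t * t ^ (((l : ℝ) - 1) / 4) := by positivity
    nlinarith [mul_le_mul_of_nonneg_right hcard' hp,
      mul_nonneg (by positivity : (0 : ℝ) ≤ (l : ℝ) + 1) hp]
  -- The term `l = 1` equals `2` and accounts for `8t` in `c(t)`; the terms `l = n + 2` form the
  -- series.
  have h4 : ∑ l ∈ Finset.Icc 1 (k - 1), ((l : ℝ) + 1) * t ^ (((l : ℝ) - 1) / 4) ≤
      2 + ∑' n : ℕ, ((n + 3 : ℕ) : ℝ) * t ^ ((((n + 3 : ℕ) : ℝ) - 2) / 4) := by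
    have h5 : Finset.Icc 1 (k - 1) ⊆ (Finset.range k).image (· + 1) := fun l hl => by
      simp only [Finset.mem_Icc, Finset.mem_image, Finset.mem_range] at hl ⊢
      exact ⟨l - 1, by omega, by omega⟩
    have h6 : (Finset.range k).image (· + 1) ⊆ (Finset.range (k + 1)).image (· + 1) :=
      Finset.image_subset_image (Finset.range_subset_range.2 (Nat.le_succ k))
    refine (Finset.sum_le_sum_of_subset_of_nonneg (h5.trans h6)
      fun l _ _ => by positivity).trans ?_
    rw [Finset.sum_image fun x _ y _ h => by simpa using h, Finset.sum_range_succ']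
    have h7 : ∀ n : ℕ, (((n + 1 + 1 : ℕ) : ℝ) + 1) * t ^ ((((n + 1 + 1 : ℕ) : ℝ) - 1) / 4) =
        ((n + 3 : ℕ) : ℝ) * t ^ ((((n + 3 : ℕ) : ℝ) - 2) / 4) := fun n => by
      have e1 : ((n + 1 + 1 : ℕ) : ℝ) + 1 = ((n + 3 : ℕ) : ℝ) := by push_cast; ring
      have e2 : ((n + 1 + 1 : ℕ) : ℝ) - 1 = ((n + 3 : ℕ) : ℝ) - 2 := by push_cast; ring
      rw [e1, e2]
    simp only [h7]
    have h8 := (summable_gapConstant ht ht1).sum_le_tsum (Finset.range k)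
      fun n _ => by positivity
    have h9 : (((0 + 1 : ℕ) : ℝ) + 1) * t ^ ((((0 + 1 : ℕ) : ℝ) - 1) / 4) = 2 := by norm_num
    rw [h9, add_comm]
    linarith
  rw [h1]
  refine h2.trans ((Finset.sum_le_sum fun l _ => h3 l).trans ?_)
  rw [← Finset.mul_sum, gapConstant]
  nlinarith

end Constants

/-! ### The form bound for the local Hamiltonian -/

section LocalForm

universe u v
variable {𝓗 : Type u} [NormedAddCommGroup 𝓗] [InnerProductSpace ℂ 𝓗] [CompleteSpace 𝓗]
variable {ι : Type v} {b : HilbertBasis ι ℂ 𝓗} {Ω : 𝓗} {H : 𝓗 →ₗ.[ℂ] 𝓗}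

/-- The form of the local Hamiltonian, sandwiched between `(H⁰ + 1)^{-1/2}`, is given by a bounded
operator `L`, and it obeys the form bound `G - E ≥ c(t) H⁰`. -/
theorem exists_localForm_operator (hH : IsSiteHamiltonian H Ω) {t : ℝ} (ht : 0 < t) (ht1 : t < 1)
    {k q : ℕ} {V : ∀ l i : ℕ, Potential b H (interval l i)} (hV : InductiveHypothesis Ω t V k q)
    {R K : TensorSpace ι (interval k q) →L[ℂ] TensorSpace ι (interval k q)}
    (h : IsResolventSqrt (freeHamiltonian b H (interval k q)) R K) :
    ∃ L : TensorSpace ι (interval k q) →L[ℂ] TensorSpace ι (interval k q),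
      (∀ x y, ⟪L x, y⟫_ℂ = ⟪x, L y⟫_ℂ) ∧
      L (vacuum b Ω (interval k q)) = (localEnergy Ω t V k q : ℂ) • vacuum b Ω (interval k q) ∧
      (∀ x y, localForm t V k q (K x) (K y) = ⟪x, L y⟫_ℂ) ∧
      ∀ y, gapConstant t * (‖y‖ ^ 2 - ‖K y‖ ^ 2) ≤
        (⟪L y, y⟫_ℂ).re - localEnergy Ω t V k q * ‖K y‖ ^ 2 := by
  choose W T hWs hWv hWf hT hWb using fun p : subIntervals k q =>
    Potential.exists_ampliation_operator hH (interval_subset p) h (hV.symmetric p.1 p.2)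
      (hV.blockDiagonal p.1 p.2) (hV.bound p.1 p.2)
  have hLx : ∀ y, (1 - R + (t : ℂ) • ∑ p, W p) y = y - R y + (t : ℂ) • ∑ p, W p y := fun y => by
    rw [add_apply, sub_apply, one_apply_eq_self, smul_apply, sum_apply]
  have hRs := h.isNonneg.symm
  -- `1 - R` represents `H⁰`, because its form is `⟨x, y⟩ - ⟨K x, K y⟩`.
  refine ⟨1 - R + (t : ℂ) • ∑ p, W p, fun x y => ?_, ?_, fun x y => ?_, fun y => ?_⟩
  · simp only [hLx, inner_add_left, inner_add_right, inner_sub_left, inner_sub_right,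
      inner_smul_left, inner_smul_right, sum_inner, inner_sum, Complex.conj_ofReal, hWs, hRs]
  · rw [hLx, ← h.mul_self, hH.sqrt_vacuum b h, hH.sqrt_vacuum b h, sub_self, zero_add]
    simp only [hWv]
    rw [← Finset.sum_smul, smul_smul, localEnergy]
    push_cast
    rfl
  · rw [localForm, h.opForm_apply, hLx, inner_add_right, inner_sub_right, inner_smul_right,
      inner_sum, ← h.mul_self y, h.symm]
    simp only [hWf]
  · have h1 := hH.sum_factor_le b h (fun p : subIntervals k q => interval p.1.1 p.1.2) T hT
      (fun p => t * (3 * t ^ (((p.1.1 : ℝ) - 1) / 4))) (1 - gapConstant t)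
      (fun i => sum_weights_le ht ht1 k q i) y
    have h2 : (⟪(1 - R + (t : ℂ) • ∑ p, W p) y, y⟫_ℂ).re =
        ‖y‖ ^ 2 - ‖K y‖ ^ 2 + t * ∑ p, (⟪W p y, y⟫_ℂ).re := by
      have h3 : (⟪y, y⟫_ℂ).re = ‖y‖ ^ 2 := inner_self_eq_norm_sq (𝕜 := ℂ) _
      rw [hLx, inner_add_left, inner_sub_left, inner_smul_left, Complex.conj_ofReal, sum_inner,
        Complex.add_re, Complex.sub_re, Complex.re_ofReal_mul, Complex.re_sum, h3,
        ← h.norm_sq_apply]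
    have h3 : ∑ p : subIntervals k q, t * (-(3 * t ^ (((p.1.1 : ℝ) - 1) / 4)) *
        (‖T p y‖ ^ 2 - ‖K y‖ ^ 2)) ≤
        ∑ p : subIntervals k q,
          t * ((⟪W p y, y⟫_ℂ).re - (V p.1.1 p.1.2).expectation Ω * ‖K y‖ ^ 2) :=
      Finset.sum_le_sum fun p _ => mul_le_mul_of_nonneg_left (hWb p y) ht.le
    have h4 : ∑ p : subIntervals k q, t * (-(3 * t ^ (((p.1.1 : ℝ) - 1) / 4)) *
        (‖T p y‖ ^ 2 - ‖K y‖ ^ 2)) = -∑ p : subIntervals k q,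
          t * (3 * t ^ (((p.1.1 : ℝ) - 1) / 4)) * (‖T p y‖ ^ 2 - ‖K y‖ ^ 2) := by
      rw [← Finset.sum_neg_distrib]
      exact Finset.sum_congr rfl fun p _ => by ring
    have h5 : ∑ p : subIntervals k q,
          t * ((⟪W p y, y⟫_ℂ).re - (V p.1.1 p.1.2).expectation Ω * ‖K y‖ ^ 2) =
        t * ∑ p, (⟪W p y, y⟫_ℂ).re - localEnergy Ω t V k q * ‖K y‖ ^ 2 := by
      rw [localEnergy, ← Finset.mul_sum, Finset.sum_sub_distrib, ← Finset.sum_mul]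
      ring
    rw [h2]
    rw [h4, h5] at h3
    linarith

end LocalForm

end QuantumChain

end

/-! ### The Lemma and the Corollary -/

open QuantumChain
theorem lemma2p1 :
    -- the form bound on the local Hamiltonians
    (∀ (𝓗 : Type*) [NormedAddCommGroup 𝓗] [InnerProductSpace ℂ 𝓗] [CompleteSpace 𝓗]
      (ι : Type*) (b : HilbertBasis ι ℂ 𝓗) (H : 𝓗 →ₗ.[ℂ] 𝓗) (Ω : 𝓗),
      IsSiteHamiltonian H Ω →
      ∀ (t : ℝ) (N k q : ℕ) (V : ∀ l i : ℕ, Potential b H (interval l i)),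
      0 < t → 0 < gapConstant t → 1 ≤ k → 1 ≤ q → q + k ≤ N →
      InductiveHypothesis Ω t V k q →
      ∀ ψ ∈ freeFormDomain b H (interval k q),
        vacuumProjCompl b Ω (interval k q) ψ ∈ freeFormDomain b H (interval k q) ∧
        gapConstant t *
            (opForm (freeHamiltonian b H (interval k q)) ψ
              (vacuumProjCompl b Ω (interval k q) ψ)).re ≤
          (localForm t V k q (vacuumProjCompl b Ω (interval k q) ψ)
            (vacuumProjCompl b Ω (interval k q) ψ)).re -
          localEnergy Ω t V k q * ‖vacuumProjCompl b Ω (interval k q) ψ‖ ^ 2) ∧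
    -- the local Hamiltonian, its ground state and its gap
    (∃ t₀ : ℝ, 0 < t₀ ∧
      ∀ (𝓗 : Type*) [NormedAddCommGroup 𝓗] [InnerProductSpace ℂ 𝓗] [CompleteSpace 𝓗]
        (ι : Type*) (b : HilbertBasis ι ℂ 𝓗) (H : 𝓗 →ₗ.[ℂ] 𝓗) (Ω : 𝓗),
        IsSiteHamiltonian H Ω →
        ∀ (t : ℝ) (N k q : ℕ) (V : ∀ l i : ℕ, Potential b H (interval l i)),
        0 < t → t < t₀ → 1 ≤ k → 1 ≤ q → q + k ≤ N →
        InductiveHypothesis Ω t V k q →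
        ∃ G : TensorSpace ι (interval k q) →ₗ.[ℂ] TensorSpace ι (interval k q),
          IsOperatorOfForm (freeFormDomain b H (interval k q)) (localForm t V k q) G ∧
          IsSelfAdjoint G ∧
          -- `E` is the ground-state energy, and the vacuum is the ground state
          IsLeast {r : ℝ | (r : ℂ) ∈ spectrumOf G} (localEnergy Ω t V k q) ∧
          (∀ ψ, (ψ, (localEnergy Ω t V k q : ℂ) • ψ) ∈ G.graph ↔
            ψ ∈ Submodule.span ℂ {vacuum b Ω (interval k q)}) ∧
          -- the rest of the spectrum lies at least `1 / 2` above
          (∀ z ∈ spectrumOf G, z = (localEnergy Ω t V k q : ℂ) ∨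
            ∃ r : ℝ, z = (r : ℂ) ∧ localEnergy Ω t V k q + 1 / 2 ≤ r) ∧
          -- the identity for the vacuum block of `G` (here `η = G P⁽⁻⁾ ψ`)
          (∀ ψ, ∃ η, (vacuumProj b Ω (interval k q) ψ, η) ∈ G.graph ∧
            vacuumProj b Ω (interval k q) η =
              vacuumProj b Ω (interval k q)
                ((t : ℂ) • ∑ p : subIntervals k q,
                  ((V p.1.1 p.1.2).expectation Ω : ℂ) •
                    projMinus b Ω (interval_subset p) (vacuumProj b Ω (interval k q) ψ)) ∧
            vacuumProj b Ω (interval k q) η =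
              vacuumProj b Ω (interval k q)
                (((t : ℂ) * ∑ p : subIntervals k q, ((V p.1.1 p.1.2).expectation Ω : ℂ)) •
                  vacuumProj b Ω (interval k q) ψ))) := by
  refine ⟨?_, 1 / 48, by norm_num, ?_⟩
  · intro 𝓗 _ _ _ ι b H Ω hH t N k q V ht hgap _ _ _ hV ψ hψ
    obtain ⟨R, K, h⟩ := hH.exists_isResolventSqrt b (interval k q)
    obtain ⟨L, hLs, -, hLf, hLb⟩ :=
      exists_localForm_operator hH ht (lt_one_of_gapConstant_pos ht hgap) hV h
    obtain ⟨y, rfl⟩ := h.mem_formDomain_iff.1 hψ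
    have hn := hH.norm_vacuum_eq b (interval k q)
    rw [vacuumProjCompl_sqrt hH h]
    refine ⟨h.apply_mem_formDomain _, ?_⟩
    set v := vacuum b Ω (interval k q)
    set z := y - lineProj v y with hz
    have h1 : ∀ x, ⟪x, x - lineProj v x⟫_ℂ = ((‖x - lineProj v x‖ ^ 2 : ℝ) : ℂ) := fun x => by
      have h2 : ⟪lineProj v x, x - lineProj v x⟫_ℂ = 0 := by
        rw [lineProj_apply, inner_smul_left, ← lineProj_apply, inner_sub_lineProj_eq_zero hn,
          mul_zero]
      have h3 : ⟪x - lineProj v x, x - lineProj v x⟫_ℂ = ⟪x, x - lineProj v x⟫_ℂ := by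
        rw [inner_sub_left, h2, sub_zero]
      rw [← h3, inner_self_eq_norm_sq_to_K]
      push_cast
      rfl
    have hKz : K z = K y - lineProj v (K y) := by
      rw [hz, map_sub, ← vacuumProj_sqrt hH h, vacuumProj_apply b hn, lineProj_apply]
    -- The one-sided form of `H⁰ P⁽⁺⁾` equals the two-sided one: `P⁽⁺⁾` is an orthogonal projection
    -- commuting with `K`, so `h1` applies both to `y` and to `K y`.
    have h2 : (opForm (freeHamiltonian b H (interval k q)) (K y) (K z)).re =
        ‖z‖ ^ 2 - ‖K z‖ ^ 2 := by
      rw [h.opForm_apply, hz, h1, ← hz, hKz, h1, Complex.sub_re, Complex.ofReal_re,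
        Complex.ofReal_re]
    rw [h2, hLf, ← hLs]
    exact hLb z
  · intro 𝓗 _ _ _ ι b H Ω hH t N k q V ht ht' _ _ _ hV
    obtain ⟨R, K, h⟩ := hH.exists_isResolventSqrt b (interval k q)
    obtain ⟨L, hLs, hLv, hLf, hLb⟩ := exists_localForm_operator hH ht (by linarith) hV h
    have hn := hH.norm_vacuum_eq b (interval k q)
    have hco : ∀ y, 1 / 2 * (‖y‖ ^ 2 - ‖K y‖ ^ 2) ≤
        (⟪L y, y⟫_ℂ).re - localEnergy Ω t V k q * ‖K y‖ ^ 2 := fun y => by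
      have h1 := half_le_gapConstant ht ht'
      have h2 := h.norm_apply_le y
      have h3 : 0 ≤ ‖y‖ ^ 2 - ‖K y‖ ^ 2 := by nlinarith [norm_nonneg (K y), norm_nonneg y]
      nlinarith [hLb y, mul_le_mul_of_nonneg_right h1 h3]
    obtain ⟨G, hG, hGs, hleast, heig, hspec⟩ := exists_operator_of_form h hn (hH.sqrt_vacuum b h)
      hLs hLv (fun y hy => hH.sqrt_gap b h hy) (fun y _ => hco y) hLf
    refine ⟨G, hG, hGs, hleast, heig, hspec, fun ψ => ?_⟩
    have hmem : vacuumProj b Ω (interval k q) ψ ∈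
        Submodule.span ℂ {vacuum b Ω (interval k q)} := by
      rw [vacuumProj_apply b hn]
      exact Submodule.smul_mem _ _ (Submodule.mem_span_singleton_self _)
    have hproj : ∀ p : subIntervals k q,
        projMinus b Ω (interval_subset p) (vacuumProj b Ω (interval k q) ψ) =
          vacuumProj b Ω (interval k q) ψ := fun p => by
      rw [vacuumProj_apply b hn, map_smul, projMinus_vacuum]
    have he : (localEnergy Ω t V k q : ℂ) =
        (t : ℂ) * ∑ p : subIntervals k q, ((V p.1.1 p.1.2).expectation Ω : ℂ) := by
      rw [localEnergy]
      push_cast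
      rfl
    -- `P⁽⁻⁾ ψ` is a multiple of the vacuum, so `η = E P⁽⁻⁾ ψ`; every `P⁽⁻⁾_{I_{l,i}}` fixes it.
    refine ⟨_, (heig _).2 hmem, ?_, ?_⟩
    · simp only [hproj]
      rw [← Finset.sum_smul, smul_smul, he]
    · rw [he]
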